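/- Let $K$ be an algebraically closed field of characteristic $0$, let $q\in K^*$, let $R=K[\tau,\sigma,\sigma^{-1}]$, and let $\alpha$ be the automorphism of $R$ with $\alpha(\tau)=\tau-1$, $\alpha(\sigma)=q^{-1}\sigma$. Let $D$ be the $K$-algebra generated over $R$ by $X,Y,Y_1$ with the relations $$YX=\tau,\quad XY=\alpha(\tau),\quad Y_1X=q\sigma-1,\quad XY_1=\alpha(q\sigma-1),\quad Y_1(\tau-1)=Y(\sigma-1),$$ $$Xr=\alpha(r)X,\quad Yr=\alpha^{-1}(r)Y,\quad Y_1r=\alpha^{-1}(r)Y_1\qquad(r\in R).$$ Let $A_q$ (respectively $A_1$) be the subalgebra of $D$ generated by $R,X,Y_1$ (respectively by $R,X,Y$). A module $V$ is a weight module if $V=\sum_{\mathfrak m\in \mathrm{Max}(R)}V_{\mathfrak m}$ with $V_{\mathfrak m}=\{v\in V:\mathfrak m v=0\}$. For $A=A_q$ put $t=q\sigma-1$, $T=Y_1$, and for $A=A_1$ put $t=\tau$, $T=Y$. Let $\omega=\{\mathfrak m_i=(\tau-a-i,\sigma-q^ib)\}_{i\in\mathbb Z}$ be an $\langle\alpha\rangle$-orbit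 in $\mathrm{Max}(R)$ (with $a\in K$, $b\in K^*$), ordered by $i$, and let $t_i\in K$ be the value of $t$ at $\mathfrak m_i$. The set of breaks is $B_\omega=\{\mathfrak m_i : t_i=0\}$, and $B'_\omega$ is $B_\omega$ together with $\alpha(\mathfrak m)$ if $B_\omega$ has a maximal element $\mathfrak m$. If $B_\omega=\emptyset$, then $V(\omega)$ is the $A$-module with basis $v_i$ of weight $\mathfrak m_i$ ($i\in\mathbb Z$), $Xv_i=t_iv_{i+1}$, $Tv_i=v_{i-1}$. If $J\subseteq B'_\omega$ is an interval and $J'\subseteq J$ does not contain the maximal element of $J$, let $\mathfrak n_0$ be the maximal break preceding all of $J$ ($-\infty$ if there is none), and let $\mathfrak n_1$ be the maximal element of $J$ if it exists and is a break, and $+\infty$ otherwise; $V(\omega,J,J')$ is the $A$-module with basis $v_i$ of weight $\mathfrak m_i$ ($\mathfrak n_0<\mathfrak m_i\le\mathfrak n_1$), $Xv_i=t_iv_{i+1}$ if $\mathfrak m_i$ is not a break, $Xv_i=v_{i+1}$ if $\mathfrak m_i\in J'$, and $Xv_i=0$ otherwise; $Tv_i=0$ if $\mathfrak m_{i-1}\in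 J'\cup\{\mathfrak n_0\}$ and $Tv_i=v_{i-1}$ otherwise. We write $V_q$ and $V_1$ for $A=A_q$ and $A=A_1$. A $D$-module extends an $A$-module $W$ if its restriction to $A$ is isomorphic to $W$. **Theorem.** Every irreducible $D$ weight module $V$ belongs to (at least) one of the following families. * Family I: $V$ is irreducible over $A_q$. * Family II: $V$ is irreducible over $A_1$. * Family III: $V$ is indecomposable but not irreducible over $A_q$ and over $A_1$, and it extends modules $V_q(\omega,J_q,J_q')$ and $V_1(\omega,J_1,J_1')$ on an infinite orbit $\omega$ that has breaks both for $A_q$ and for $A_1$. Moreover, up to isomorphism of $D$-modules, the families consist exactly of the following modules. In all of them $v_i$ has weight $\mathfrak m_i=(\tau-a-i,\sigma-q^ib)$. * Family I: * the modules $V_q(\omega,b,a)$, where $a\in K$, $b\in K^*\setminus\{q^i\}_{i\in\mathbb Z}$, with basis $v_i$ ($i\in\mathbb Z$), $Xv_i=(q^{i+1}b-1)v_{i+1}$, $Y_1v_i=v_{i-1}$, $Yv_i=\frac{a+i-1}{q^ib-1}v_{i-1}$; they extend $V_q(\omega)$; * if $q$ is not a root of unity, with $a=0$, $b=q^{-1}$,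 the two modules with basis $v_i$ ($i\le0$), respectively $v_i$ ($i\ge1$), and $Xv_i=(q^i-1)v_{i+1}$, $Y_1v_i=v_{i-1}$, $Yv_i=\frac{i-1}{q^{i-1}-1}v_{i-1}$, where $Xv_0=0$ in the first case and $Yv_1=Y_1v_1=0$ in the second; they extend $V_q(\omega,\{\mathfrak m_0\},\emptyset)$ and $V_q(\omega,\{\mathfrak m_1\},\emptyset)$. * Family II: * the modules $V_1(\omega,a,b)$, where $a\in K\setminus\mathbb Z$, $b\in K^*$, with basis $v_i$ ($i\in\mathbb Z$), $Xv_i=(a+i)v_{i+1}$, $Yv_i=v_{i-1}$, $Y_1v_i=\frac{q^ib-1}{a+i-1}v_{i-1}$; they extend $V_1(\omega)$; * with $a=0$, $b=q^{-1}$, the two modules with basis $v_i$ ($i\le0$), respectively $v_i$ ($i\ge1$), and $Xv_i=iv_{i+1}$, $Yv_i=v_{i-1}$, $Y_1v_i=\frac{q^{i-1}-1}{i-1}v_{i-1}$, where $Xv_0=0$ in the first case and $Yv_1=Y_1v_1=0$ in the second; they extend $V_1(\omega,\{\mathfrak m_0\},\emptyset)$ and $V_1(\omega,\{\mathfrak m_1\},\emptyset)$.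 * Family III: the modules $V_1(\omega,J,J',b)$ with $b\in\{q^i\}_{i\in\mathbb Z}$, $b\ne q^{-1}$. Here, for any $b\in K^*$, $V_1(\omega,J,J',b)$ is the $D$-module with $a=0$, basis $v_i$ ($i\in\mathbb Z$), $Xv_0=v_1$, $Xv_i=iv_{i+1}$ ($i\ne0$), $Yv_1=0$, $Yv_i=v_{i-1}$ ($i\ne1$), $Y_1v_1=(qb-1)v_0$, $Y_1v_i=\frac{q^ib-1}{i-1}v_{i-1}$ ($i\neq1$). For every $b\in K^*$ the module $V_1(\omega,J,J',b)$ extends $V_1(\omega,\{\mathfrak m_0,\mathfrak m_1\},\{\mathfrak m_0\})$; it extends $V_q(\omega,B'_\omega,B_\omega)$ (breaks taken for $A_q$) if $b\in\{q^i\}_{i\in\mathbb Z}$; and it is an irreducible $D$ weight module if and only if $b\neq q^{-1}$. For $c,d\in K$ the $D$-module $V_1(\omega,J,J',c,d)$ with $a=0$, $b=q^{-1}$, basis $v_i$ ($i\in\mathbb Z$), $Xv_i=iv_{i+1}$, $Yv_1=cv_0$, $Yv_i=v_{i-1}$ ($i\ne1$), $Y_1v_1=dv_0$, $Y_1v_i=\frac{q^{i-1}-1}{i-1}v_{i-1}$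 ($i\neq1$), is never irreducible. -/

import Mathlib

universe u v

noncomputable section

namespace QDiff

/-! ### The base ring and its automorphism -/

/-- The ring `R = K[τ, σ, σ⁻¹]`: the localization of the polynomial ring `K[τ, σ]` at the powers
of `σ`. The variable with index `0` is `τ`, the one with index `1` is `σ`. -/
abbrev BaseRing (K : Type u) [Field K] : Type u :=
  Localization.Away (MvPolynomial.X 1 : MvPolynomial (Fin 2) K)

section Base

variable (K : Type u) [Field K]

/-- The element `τ` of `R`. -/
def tau : BaseRing K := algebraMap (MvPolynomial (Fin 2) K) (BaseRing K) (MvPolynomial.X 0)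

/-- The element `σ` of `R`. -/
def sigma : BaseRing K := algebraMap (MvPolynomial (Fin 2) K) (BaseRing K) (MvPolynomial.X 1)

theorem isUnit_sigma : IsUnit (sigma K) :=
  IsLocalization.Away.algebraMap_isUnit (MvPolynomial.X 1 : MvPolynomial (Fin 2) K)

variable {K}

/-- The `K`-algebra homomorphism from `R` that sends `τ` to `s` and `σ` to the unit `w`. -/
def liftR {S : Type v} [CommRing S] [Algebra K S] (s : S) (w : Sˣ) : BaseRing K →ₐ[K] S :=
  IsLocalization.liftAlgHom (M := Submonoid.powers (MvPolynomial.X 1 : MvPolynomial (Fin 2) K))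
    (f := MvPolynomial.aeval ![s, (w : S)]) (by
      rintro ⟨y, n, rfl⟩
      simpa using w.isUnit.pow n)

@[simp] theorem liftR_tau {S : Type v} [CommRing S] [Algebra K S] (s : S) (w : Sˣ) :
    liftR (K := K) s w (tau K) = s := by
  simp [liftR, tau, IsLocalization.liftAlgHom_apply]

@[simp] theorem liftR_sigma {S : Type v} [CommRing S] [Algebra K S] (s : S) (w : Sˣ) :
    liftR (K := K) s w (sigma K) = w := by
  simp [liftR, sigma, IsLocalization.liftAlgHom_apply]

theorem hom_extR {S : Type v} [CommRing S] [Algebra K S] {f g : BaseRing K →ₐ[K] S}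
    (h₀ : f (tau K) = g (tau K)) (h₁ : f (sigma K) = g (sigma K)) : f = g := by
  apply Localization.algHom_ext
  apply MvPolynomial.algHom_ext
  intro i
  fin_cases i
  · exact h₀
  · exact h₁

/-- The `K`-algebra endomorphism `τ ↦ τ + c`, `σ ↦ w σ` of `R`. -/
def affineHom (c : K) (w : Kˣ) : BaseRing K →ₐ[K] BaseRing K :=
  liftR (tau K + algebraMap K (BaseRing K) c)
    (Units.map (algebraMap K (BaseRing K)).toMonoidHom w * (isUnit_sigma K).unit)

@[simp] theorem affineHom_tau (c : K) (w : Kˣ) :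
    affineHom c w (tau K) = tau K + algebraMap K (BaseRing K) c := by
  simp [affineHom]

@[simp] theorem affineHom_sigma (c : K) (w : Kˣ) :
    affineHom c w (sigma K) = algebraMap K (BaseRing K) w * sigma K := by
  simp [affineHom]

/-- The automorphism `α` of `R` with `α(τ) = τ - 1` and `α(σ) = q⁻¹ σ`. -/
def alpha (q : Kˣ) : BaseRing K ≃ₐ[K] BaseRing K :=
  AlgEquiv.ofAlgHom (affineHom (-1) q⁻¹) (affineHom 1 q)
    (hom_extR (by simp) (by
      simp only [AlgHom.comp_apply, affineHom_sigma, map_mul, AlgHom.commutes, ← mul_assoc]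
      simp [← map_mul]))
    (hom_extR (by simp) (by
      simp only [AlgHom.comp_apply, affineHom_sigma, map_mul, AlgHom.commutes, ← mul_assoc]
      simp [← map_mul]))

@[simp] theorem alpha_tau (q : Kˣ) : alpha q (tau K) = tau K - 1 := by
  simp [alpha, sub_eq_add_neg]

@[simp] theorem alpha_sigma (q : Kˣ) :
    alpha q (sigma K) = algebraMap K (BaseRing K) ((q⁻¹ : Kˣ) : K) * sigma K := by
  simp [alpha]

/-- The element `q σ - 1` of `R`. -/
def kappa (q : Kˣ) : BaseRing K := algebraMap K (BaseRing K) (q : K) * sigma K - 1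

end Base

/-! ### The algebra `D` -/

section Algebras

variable (K : Type u) [Field K] (q : Kˣ)

/-- Generators of `D`: the elements of `R` and `X`, `Y`, `Y₁`. -/
inductive DGen : Type u
  | coef (r : BaseRing K) : DGen
  | X : DGen
  | Y : DGen
  | Y₁ : DGen

/-- The defining relations of `D`. The first three say that `R` maps to `D` by a homomorphism of
`K`-algebras, the others are the relations between `X`, `Y`, `Y₁` and `R`. -/
inductive DRel : FreeAlgebra K (DGen K) → FreeAlgebra K (DGen K) → Prop
  | add (r s : BaseRing K) : DRel (FreeAlgebra.ι K (.coef (r + s)))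
      (FreeAlgebra.ι K (.coef r) + FreeAlgebra.ι K (.coef s))
  | mul (r s : BaseRing K) : DRel (FreeAlgebra.ι K (.coef (r * s)))
      (FreeAlgebra.ι K (.coef r) * FreeAlgebra.ι K (.coef s))
  | scalar (c : K) : DRel (FreeAlgebra.ι K (.coef (algebraMap K (BaseRing K) c)))
      (algebraMap K (FreeAlgebra K (DGen K)) c)
  | YX : DRel (FreeAlgebra.ι K .Y * FreeAlgebra.ι K .X) (FreeAlgebra.ι K (.coef (tau K)))
  | XY : DRel (FreeAlgebra.ι K .X * FreeAlgebra.ι K .Y)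
      (FreeAlgebra.ι K (.coef (alpha q (tau K))))
  | Y₁X : DRel (FreeAlgebra.ι K .Y₁ * FreeAlgebra.ι K .X) (FreeAlgebra.ι K (.coef (kappa q)))
  | XY₁ : DRel (FreeAlgebra.ι K .X * FreeAlgebra.ι K .Y₁)
      (FreeAlgebra.ι K (.coef (alpha q (kappa q))))
  | Y₁Y : DRel (FreeAlgebra.ι K .Y₁ * FreeAlgebra.ι K (.coef (tau K - 1)))
      (FreeAlgebra.ι K .Y * FreeAlgebra.ι K (.coef (sigma K - 1)))
  | X_coef (r : BaseRing K) : DRel (FreeAlgebra.ι K .X * FreeAlgebra.ι K (.coef r))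
      (FreeAlgebra.ι K (.coef (alpha q r)) * FreeAlgebra.ι K .X)
  | Y_coef (r : BaseRing K) : DRel (FreeAlgebra.ι K .Y * FreeAlgebra.ι K (.coef r))
      (FreeAlgebra.ι K (.coef ((alpha q).symm r)) * FreeAlgebra.ι K .Y)
  | Y₁_coef (r : BaseRing K) : DRel (FreeAlgebra.ι K .Y₁ * FreeAlgebra.ι K (.coef r))
      (FreeAlgebra.ι K (.coef ((alpha q).symm r)) * FreeAlgebra.ι K .Y₁)

/-- The algebra `D`. -/
abbrev D : Type u := RingQuot (DRel K q)

/-- The image in `D` of a generator. -/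
def D.gen (g : DGen K) : D K q := RingQuot.mkAlgHom K (DRel K q) (FreeAlgebra.ι K g)

/-- The structure homomorphism `R → D`. -/
def D.coef : BaseRing K →ₐ[K] D K q :=
  AlgHom.ofLinearMap
    { toFun := fun r => D.gen K q (.coef r)
      map_add' := fun r s => by
        simpa [D.gen] using RingQuot.mkAlgHom_rel K (DRel.add (q := q) r s)
      map_smul' := fun c r => by
        have h₁ := RingQuot.mkAlgHom_rel K (DRel.mul (q := q) (algebraMap K (BaseRing K) c) r)
        have h₂ := RingQuot.mkAlgHom_rel K (DRel.scalar (q := q) c)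
        rw [map_mul, h₂, AlgHom.commutes, ← Algebra.smul_def, ← Algebra.smul_def] at h₁
        exact h₁ }
    (by
      have h₂ := RingQuot.mkAlgHom_rel K (DRel.scalar (q := q) (1 : K))
      simpa [D.gen] using h₂)
    (fun r s => by
      simpa [D.gen] using RingQuot.mkAlgHom_rel K (DRel.mul (q := q) r s))

/-- The element `X` of `D`. -/
def D.X : D K q := D.gen K q .X

/-- The element `Y` of `D`. -/
def D.Y : D K q := D.gen K q .Y

/-- The element `Y₁` of `D`. -/
def D.Y₁ : D K q := D.gen K q .Y₁

theorem D.Y_mul_X : D.Y K q * D.X K q = D.coef K q (tau K) :=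
  (map_mul _ _ _).symm.trans (RingQuot.mkAlgHom_rel K DRel.YX)

theorem D.X_mul_Y : D.X K q * D.Y K q = D.coef K q (alpha q (tau K)) :=
  (map_mul _ _ _).symm.trans (RingQuot.mkAlgHom_rel K DRel.XY)

theorem D.Y₁_mul_X : D.Y₁ K q * D.X K q = D.coef K q (kappa q) :=
  (map_mul _ _ _).symm.trans (RingQuot.mkAlgHom_rel K DRel.Y₁X)

theorem D.X_mul_Y₁ : D.X K q * D.Y₁ K q = D.coef K q (alpha q (kappa q)) :=
  (map_mul _ _ _).symm.trans (RingQuot.mkAlgHom_rel K DRel.XY₁)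

theorem D.X_mul_coef (r : BaseRing K) :
    D.X K q * D.coef K q r = D.coef K q (alpha q r) * D.X K q :=
  (map_mul _ _ _).symm.trans ((RingQuot.mkAlgHom_rel K (DRel.X_coef r)).trans (map_mul _ _ _))

theorem D.Y_mul_coef (r : BaseRing K) :
    D.Y K q * D.coef K q r = D.coef K q ((alpha q).symm r) * D.Y K q :=
  (map_mul _ _ _).symm.trans ((RingQuot.mkAlgHom_rel K (DRel.Y_coef r)).trans (map_mul _ _ _))

theorem D.Y₁_mul_coef (r : BaseRing K) :
    D.Y₁ K q * D.coef K q r = D.coef K q ((alpha q).symm r) * D.Y₁ K q :=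
  (map_mul _ _ _).symm.trans ((RingQuot.mkAlgHom_rel K (DRel.Y₁_coef r)).trans (map_mul _ _ _))

/-- The subalgebra `A_q` of `D` generated by `R`, `X` and `Y₁`. -/
def Aq : Subalgebra K (D K q) :=
  Algebra.adjoin K (Set.range (D.coef K q) ∪ {D.X K q, D.Y₁ K q})

/-- The subalgebra `A_1` of `D` generated by `R`, `X` and `Y`. -/
def A1 : Subalgebra K (D K q) :=
  Algebra.adjoin K (Set.range (D.coef K q) ∪ {D.X K q, D.Y K q})

/-! ### Generalized Weyl algebras over `R` -/

/-- Generators of a generalized Weyl algebra over `R`: the elements of `R`, and `X`, `T`. -/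
inductive GGen : Type u
  | coef (r : BaseRing K) : GGen
  | X : GGen
  | T : GGen

/-- The defining relations of the generalized Weyl algebra `R(α, t)`. -/
inductive GRel (t : BaseRing K) : FreeAlgebra K (GGen K) → FreeAlgebra K (GGen K) → Prop
  | add (r s : BaseRing K) : GRel t (FreeAlgebra.ι K (.coef (r + s)))
      (FreeAlgebra.ι K (.coef r) + FreeAlgebra.ι K (.coef s))
  | mul (r s : BaseRing K) : GRel t (FreeAlgebra.ι K (.coef (r * s)))
      (FreeAlgebra.ι K (.coef r) * FreeAlgebra.ι K (.coef s))
  | scalar (c : K) : GRel t (FreeAlgebra.ι K (.coef (algebraMap K (BaseRing K) c)))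
      (algebraMap K (FreeAlgebra K (GGen K)) c)
  | TX : GRel t (FreeAlgebra.ι K .T * FreeAlgebra.ι K .X) (FreeAlgebra.ι K (.coef t))
  | XT : GRel t (FreeAlgebra.ι K .X * FreeAlgebra.ι K .T)
      (FreeAlgebra.ι K (.coef (alpha q t)))
  | X_coef (r : BaseRing K) : GRel t (FreeAlgebra.ι K .X * FreeAlgebra.ι K (.coef r))
      (FreeAlgebra.ι K (.coef (alpha q r)) * FreeAlgebra.ι K .X)
  | T_coef (r : BaseRing K) : GRel t (FreeAlgebra.ι K .T * FreeAlgebra.ι K (.coef r))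
      (FreeAlgebra.ι K (.coef ((alpha q).symm r)) * FreeAlgebra.ι K .T)

/-- The generalized Weyl algebra generated over `R` by `X` and `T` with `T X = t`,
`X T = α(t)`, `X r = α(r) X` and `T r = α⁻¹(r) T`. -/
abbrev GWA (t : BaseRing K) : Type u := RingQuot (GRel K q t)

/-- The homomorphism from the generalized Weyl algebra with `t = q σ - 1` to `D` which is the
identity on `R` and sends `X` to `X` and `T` to `Y₁`. Its image is `A_q`. -/
def toAq : GWA K q (kappa q) →ₐ[K] D K q :=
  RingQuot.liftAlgHom K ⟨FreeAlgebra.lift K fun g => match g with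
    | .coef r => D.coef K q r
    | .X => D.X K q
    | .T => D.Y₁ K q, by
      intro x y h
      induction h with
      | add r s => simp
      | mul r s => simp
      | scalar c => simp
      | TX => simpa using D.Y₁_mul_X K q
      | XT => simpa using D.X_mul_Y₁ K q
      | X_coef r => simpa using D.X_mul_coef K q r
      | T_coef r => simpa using D.Y₁_mul_coef K q r⟩

/-- The homomorphism from the generalized Weyl algebra with `t = τ` to `D` which is the
identity on `R` and sends `X` to `X` and `T` to `Y`. Its image is `A_1`. -/
def toA1 : GWA K q (tau K) →ₐ[K] D K q :=
  RingQuot.liftAlgHom K ⟨FreeAlgebra.lift K fun g => match g with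
    | .coef r => D.coef K q r
    | .X => D.X K q
    | .T => D.Y K q, by
      intro x y h
      induction h with
      | add r s => simp
      | mul r s => simp
      | scalar c => simp
      | TX => simpa using D.Y_mul_X K q
      | XT => simpa using D.X_mul_Y K q
      | X_coef r => simpa using D.X_mul_coef K q r
      | T_coef r => simpa using D.Y_mul_coef K q r⟩

/-- The image of the generalized Weyl algebra with `t = q σ - 1` in `D` is `A_q`. -/
theorem range_toAq : (toAq K q).range = Aq K q := by
  apply le_antisymm
  · rintro _ ⟨g, rfl⟩
    obtain ⟨x, rfl⟩ := RingQuot.mkAlgHom_surjective K _ g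
    induction x using FreeAlgebra.induction with
    | grade0 c => simp
    | grade1 g =>
      cases g with
      | coef r => exact Algebra.subset_adjoin (by simp [toAq])
      | X => exact Algebra.subset_adjoin (by simp [toAq])
      | T => exact Algebra.subset_adjoin (by simp [toAq])
    | mul a b ha hb => simpa using (Aq K q).mul_mem ha hb
    | add a b ha hb => simpa using (Aq K q).add_mem ha hb
  · refine Algebra.adjoin_le ?_
    rintro x (⟨r, rfl⟩ | rfl | rfl)
    · exact ⟨RingQuot.mkAlgHom K _ (FreeAlgebra.ι K (.coef r)), by simp [toAq]⟩
    · exact ⟨RingQuot.mkAlgHom K _ (FreeAlgebra.ι K .X), by simp [toAq]⟩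
    · exact ⟨RingQuot.mkAlgHom K _ (FreeAlgebra.ι K .T), by simp [toAq]⟩

/-- The image of the generalized Weyl algebra with `t = τ` in `D` is `A_1`. -/
theorem range_toA1 : (toA1 K q).range = A1 K q := by
  apply le_antisymm
  · rintro _ ⟨g, rfl⟩
    obtain ⟨x, rfl⟩ := RingQuot.mkAlgHom_surjective K _ g
    induction x using FreeAlgebra.induction with
    | grade0 c => simp
    | grade1 g =>
      cases g with
      | coef r => exact Algebra.subset_adjoin (by simp [toA1])
      | X => exact Algebra.subset_adjoin (by simp [toA1])
      | T => exact Algebra.subset_adjoin (by simp [toA1])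
    | mul a b ha hb => simpa using (A1 K q).mul_mem ha hb
    | add a b ha hb => simpa using (A1 K q).add_mem ha hb
  · refine Algebra.adjoin_le ?_
    rintro x (⟨r, rfl⟩ | rfl | rfl)
    · exact ⟨RingQuot.mkAlgHom K _ (FreeAlgebra.ι K (.coef r)), by simp [toA1]⟩
    · exact ⟨RingQuot.mkAlgHom K _ (FreeAlgebra.ι K .X), by simp [toA1]⟩
    · exact ⟨RingQuot.mkAlgHom K _ (FreeAlgebra.ι K .T), by simp [toA1]⟩

end Algebras

/-! ### Modules with a basis of weight vectors along a linear orbit -/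

section Chains

variable {K : Type u} [Field K]

/-- Evaluation `R → K` at the point `τ = a + i`, `σ = q ^ i b`; its kernel is the maximal ideal
`α ^ i (τ - a, σ - b) = (τ - a - i, σ - q ^ i b)`. -/
def pt (q : Kˣ) (a : K) (b : Kˣ) (i : ℤ) : BaseRing K →ₐ[K] K := liftR (a + i) (q ^ i * b)

@[simp] theorem pt_tau (q : Kˣ) (a : K) (b : Kˣ) (i : ℤ) : pt q a b i (tau K) = a + i := by
  simp [pt]

@[simp] theorem pt_sigma (q : Kˣ) (a : K) (b : Kˣ) (i : ℤ) :
    pt q a b i (sigma K) = ((q ^ i * b : Kˣ) : K) := by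
  simp only [pt, liftR_sigma]

@[simp] theorem pt_kappa (q : Kˣ) (a : K) (b : Kˣ) (i : ℤ) :
    pt q a b i (kappa q) = ((q ^ (i + 1) * b : Kˣ) : K) - 1 := by
  simp only [kappa, map_sub, map_mul, AlgHom.commutes, pt_sigma, map_one, Algebra.algebraMap_self,
    RingHom.id_apply, zpow_add_one, Units.val_mul]
  ring

theorem pt_alpha (q : Kˣ) (a : K) (b : Kˣ) (i : ℤ) (r : BaseRing K) :
    pt q a b i (alpha q r) = pt q a b (i - 1) r := by
  have h : (pt q a b i).comp (alpha q : BaseRing K →ₐ[K] BaseRing K) = pt q a b (i - 1) := by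
    apply hom_extR
    · simp [add_sub_assoc]
    · change pt q a b i (alpha q (sigma K)) = _
      rw [alpha_sigma, map_mul, AlgHom.commutes, pt_sigma, pt_sigma, Algebra.algebraMap_self,
        RingHom.id_apply, ← Units.val_mul, zpow_sub_one, ← mul_assoc, mul_comm q⁻¹]
  exact DFunLike.congr_fun h r

theorem pt_alpha_symm (q : Kˣ) (a : K) (b : Kˣ) (i : ℤ) (r : BaseRing K) :
    pt q a b i ((alpha q).symm r) = pt q a b (i + 1) r := by
  have h := pt_alpha q a b (i + 1) ((alpha q).symm r)
  rw [AlgEquiv.apply_symm_apply, add_sub_cancel_right] at h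
  exact h.symm

open Classical in
/-- On the vector space with basis `v_i`, `i ∈ I`, the operator `v_i ↦ f(i) v_{i+s}`, where
`v_j` is read as `0` for `j ∉ I`. -/
def shiftOp (I : Set ℤ) (s : ℤ) (f : ℤ → K) : Module.End K (I →₀ K) :=
  Finsupp.lsum K fun i : I =>
    if h : (i : ℤ) + s ∈ I then f i • Finsupp.lsingle (⟨i + s, h⟩ : I) else 0

theorem shiftOp_single_of_mem (I : Set ℤ) (s : ℤ) (f : ℤ → K) (i : I) (c : K)
    (h : (i : ℤ) + s ∈ I) :
    shiftOp I s f (Finsupp.single i c) = Finsupp.single (⟨i + s, h⟩ : I) (f i * c) := by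
  simp [shiftOp, h]

theorem shiftOp_single_of_notMem (I : Set ℤ) (s : ℤ) (f : ℤ → K) (i : I) (c : K)
    (h : (i : ℤ) + s ∉ I) : shiftOp I s f (Finsupp.single i c) = 0 := by
  simp [shiftOp, h]

/-- The action of `R` on the vector space with basis `v_i`, `i ∈ I`, for which `v_i` is a weight
vector of weight `(τ - a - i, σ - q ^ i b)`. -/
def weightOp (q : Kˣ) (a : K) (b : Kˣ) (I : Set ℤ) : BaseRing K →ₐ[K] Module.End K (I →₀ K) :=
  AlgHom.ofLinearMap
    { toFun := fun r => Finsupp.lsum K fun i : I => pt q a b i r • Finsupp.lsingle i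
      map_add' := fun r s => by
        ext i : 2
        simp
      map_smul' := fun c r => by
        ext i : 2
        simp }
    (by ext i : 2; simp)
    (fun r s => by ext i : 2; simp)

@[simp] theorem weightOp_single (q : Kˣ) (a : K) (b : Kˣ) (I : Set ℤ) (r : BaseRing K) (i : I)
    (c : K) :
    weightOp q a b I r (Finsupp.single i c) = Finsupp.single i (pt q a b i r * c) := by
  simp [weightOp]

theorem up_weight (q : Kˣ) (a : K) (b : Kˣ) (I : Set ℤ) (f : ℤ → K) (r : BaseRing K) :
    shiftOp I 1 f * weightOp q a b I r = weightOp q a b I (alpha q r) * shiftOp I 1 f := by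
  refine Finsupp.lhom_ext fun i c => ?_
  simp only [Module.End.mul_apply, weightOp_single]
  by_cases h : (i : ℤ) + 1 ∈ I
  · simp only [shiftOp_single_of_mem _ _ _ _ _ h, weightOp_single, pt_alpha, add_sub_cancel_right]
    congr 1
    ring
  · simp only [shiftOp_single_of_notMem _ _ _ _ _ h, map_zero]

theorem down_weight (q : Kˣ) (a : K) (b : Kˣ) (I : Set ℤ) (f : ℤ → K) (r : BaseRing K) :
    shiftOp I (-1) f * weightOp q a b I r =
      weightOp q a b I ((alpha q).symm r) * shiftOp I (-1) f := by
  refine Finsupp.lhom_ext fun i c => ?_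
  simp only [Module.End.mul_apply, weightOp_single]
  by_cases h : (i : ℤ) + -1 ∈ I
  · simp only [shiftOp_single_of_mem _ _ _ _ _ h, weightOp_single, pt_alpha_symm,
      neg_add_cancel_right]
    congr 1
    ring
  · simp only [shiftOp_single_of_notMem _ _ _ _ _ h, map_zero]

theorem down_up (q : Kˣ) (a : K) (b : Kˣ) (I : Set ℤ) (x y : ℤ → K) (t : BaseRing K)
    (h₁ : ∀ i ∈ I, i + 1 ∈ I → x i * y (i + 1) = pt q a b i t)
    (h₂ : ∀ i ∈ I, i + 1 ∉ I → pt q a b i t = 0) :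
    shiftOp I (-1) y * shiftOp I 1 x = weightOp q a b I t := by
  refine Finsupp.lhom_ext fun i c => ?_
  simp only [Module.End.mul_apply, weightOp_single]
  by_cases h : (i : ℤ) + 1 ∈ I
  · have h' : ((⟨i + 1, h⟩ : I) : ℤ) + -1 ∈ I := by simp
    rw [shiftOp_single_of_mem _ _ _ _ _ h, shiftOp_single_of_mem _ _ _ _ _ h', ← h₁ i i.2 h]
    congr 1
    · ext
      simp
    · ring
  · rw [shiftOp_single_of_notMem _ _ _ _ _ h, h₂ i i.2 h]
    simp

theorem up_down (q : Kˣ) (a : K) (b : Kˣ) (I : Set ℤ) (x y : ℤ → K) (t : BaseRing K)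
    (h₁ : ∀ i ∈ I, i + 1 ∈ I → x i * y (i + 1) = pt q a b i t)
    (h₃ : ∀ i ∈ I, i - 1 ∉ I → pt q a b (i - 1) t = 0) :
    shiftOp I 1 x * shiftOp I (-1) y = weightOp q a b I (alpha q t) := by
  refine Finsupp.lhom_ext fun i c => ?_
  simp only [Module.End.mul_apply, weightOp_single, pt_alpha]
  by_cases h : (i : ℤ) + -1 ∈ I
  · have h' : ((⟨i + -1, h⟩ : I) : ℤ) + 1 ∈ I := by simp
    have h₀ := h₁ (i - 1) h (by simp)
    rw [sub_add_cancel] at h₀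
    rw [shiftOp_single_of_mem _ _ _ _ _ h, shiftOp_single_of_mem _ _ _ _ _ h', ← h₀]
    congr 1
    · ext
      simp
    · simp only [← sub_eq_add_neg]
      ring
  · rw [shiftOp_single_of_notMem _ _ _ _ _ h, h₃ i i.2 h]
    simp

/-- Data for a module over the generalized Weyl algebra `R(α, t)` with basis `v_i`, `i ∈ I`,
such that `v_i` has weight `(τ - a - i, σ - q ^ i b)`, `X v_i = x(i) v_{i+1}` and
`T v_i = y(i) v_{i-1}` (with `v_j = 0` for `j ∉ I`). The three conditions say that `T X = t` and
`X T = α(t)` hold on the basis. -/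
structure GChain (q : Kˣ) (t : BaseRing K) where
  I : Set ℤ
  a : K
  b : Kˣ
  x : ℤ → K
  y : ℤ → K
  mid : ∀ i ∈ I, i + 1 ∈ I → x i * y (i + 1) = pt q a b i t
  top : ∀ i ∈ I, i + 1 ∉ I → pt q a b i t = 0
  bot : ∀ i ∈ I, i - 1 ∉ I → pt q a b (i - 1) t = 0

/-- Data for a module over `D` with basis `v_i`, `i ∈ I`, such that `v_i` has weight
`(τ - a - i, σ - q ^ i b)`, `X v_i = x(i) v_{i+1}`, `Y v_i = y(i) v_{i-1}` and
`Y₁ v_i = z(i) v_{i-1}` (with `v_j = 0` for `j ∉ I`). The conditions say that the relations of `D`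
hold on the basis. -/
structure DChain (q : Kˣ) where
  I : Set ℤ
  a : K
  b : Kˣ
  x : ℤ → K
  y : ℤ → K
  z : ℤ → K
  midY : ∀ i ∈ I, i + 1 ∈ I → x i * y (i + 1) = a + i
  topY : ∀ i ∈ I, i + 1 ∉ I → a + i = 0
  botY : ∀ i ∈ I, i - 1 ∉ I → a + (i - 1) = 0
  midY₁ : ∀ i ∈ I, i + 1 ∈ I → x i * z (i + 1) = ((q ^ (i + 1) * b : Kˣ) : K) - 1
  topY₁ : ∀ i ∈ I, i + 1 ∉ I → ((q ^ (i + 1) * b : Kˣ) : K) - 1 = 0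
  botY₁ : ∀ i ∈ I, i - 1 ∉ I → ((q ^ i * b : Kˣ) : K) - 1 = 0
  compat : ∀ i ∈ I, i - 1 ∈ I → z i * (a + i - 1) = y i * (((q ^ i * b : Kˣ) : K) - 1)

namespace GChain

variable {q : Kˣ} {t : BaseRing K} (d : GChain q t)

/-- The underlying vector space, with basis indexed by `I`. -/
def Mod : Type u := d.I →₀ K

instance : AddCommGroup d.Mod := inferInstanceAs (AddCommGroup (d.I →₀ K))

instance : Module K d.Mod := inferInstanceAs (Module K (d.I →₀ K))

/-- The action of the generalized Weyl algebra. -/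
def rep : GWA K q t →ₐ[K] Module.End K (d.I →₀ K) :=
  RingQuot.liftAlgHom K ⟨FreeAlgebra.lift K fun g => match g with
    | .coef r => weightOp q d.a d.b d.I r
    | .X => shiftOp d.I 1 d.x
    | .T => shiftOp d.I (-1) d.y, by
      intro x y h
      induction h with
      | add r s => simp
      | mul r s => simp
      | scalar c => simp
      | TX => simpa using down_up q d.a d.b d.I d.x d.y t d.mid d.top
      | XT => simpa using up_down q d.a d.b d.I d.x d.y t d.mid d.bot
      | X_coef r => simpa using up_weight q d.a d.b d.I d.x r
      | T_coef r => simpa using down_weight q d.a d.b d.I d.y r⟩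

instance : Module (GWA K q t) d.Mod := Module.compHom (d.I →₀ K) d.rep.toRingHom

theorem smul_def (g : GWA K q t) (v : d.Mod) : g • v = d.rep g v := rfl

end GChain

namespace DChain

variable {q : Kˣ} (d : DChain q)

/-- The underlying vector space, with basis indexed by `I`. -/
def Mod : Type u := d.I →₀ K

instance : AddCommGroup d.Mod := inferInstanceAs (AddCommGroup (d.I →₀ K))

instance : Module K d.Mod := inferInstanceAs (Module K (d.I →₀ K))

theorem compat_op :
    shiftOp d.I (-1) d.z * weightOp q d.a d.b d.I (tau K - 1) =
      shiftOp d.I (-1) d.y * weightOp q d.a d.b d.I (sigma K - 1) := by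
  refine Finsupp.lhom_ext fun i c => ?_
  simp only [Module.End.mul_apply, weightOp_single]
  by_cases h : (i : ℤ) + -1 ∈ d.I
  · have h₀ := d.compat i i.2 h
    simp only [shiftOp_single_of_mem _ _ _ _ _ h, map_sub, pt_tau, pt_sigma, map_one]
    rw [← mul_assoc, ← mul_assoc, h₀]
  · simp only [shiftOp_single_of_notMem _ _ _ _ _ h]

/-- The action of `D`. -/
def rep : D K q →ₐ[K] Module.End K (d.I →₀ K) :=
  RingQuot.liftAlgHom K ⟨FreeAlgebra.lift K fun g => match g with
    | .coef r => weightOp q d.a d.b d.I r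
    | .X => shiftOp d.I 1 d.x
    | .Y => shiftOp d.I (-1) d.y
    | .Y₁ => shiftOp d.I (-1) d.z, by
      have hY : ∀ i ∈ d.I, i + 1 ∈ d.I → d.x i * d.y (i + 1) = pt q d.a d.b i (tau K) := by
        simpa using d.midY
      have hY₁ : ∀ i ∈ d.I, i + 1 ∈ d.I → d.x i * d.z (i + 1) = pt q d.a d.b i (kappa q) := by
        simpa only [pt_kappa] using d.midY₁
      intro x y h
      induction h with
      | add r s => simp
      | mul r s => simp
      | scalar c => simp
      | YX => simpa using down_up q d.a d.b d.I d.x d.y (tau K) hY (by simpa using d.topY)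
      | XY => simpa using up_down q d.a d.b d.I d.x d.y (tau K) hY (by simpa using d.botY)
      | Y₁X => simpa using down_up q d.a d.b d.I d.x d.z (kappa q) hY₁
                (by simpa only [pt_kappa] using d.topY₁)
      | XY₁ => simpa using up_down q d.a d.b d.I d.x d.z (kappa q) hY₁
                (by simpa only [pt_kappa, sub_add_cancel] using d.botY₁)
      | Y₁Y => simpa using d.compat_op
      | X_coef r => simpa using up_weight q d.a d.b d.I d.x r
      | Y_coef r => simpa using down_weight q d.a d.b d.I d.y r
      | Y₁_coef r => simpa using down_weight q d.a d.b d.I d.z r⟩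

instance : Module (D K q) d.Mod := Module.compHom (d.I →₀ K) d.rep.toRingHom

theorem smul_def (g : D K q) (v : d.Mod) : g • v = d.rep g v := rfl

instance : IsScalarTower K (D K q) d.Mod where
  smul_assoc c g v := by
    change d.rep (c • g) v = c • d.rep g v
    exact LinearMap.congr_fun (map_smul d.rep c g) v

end DChain

end Chains

/-! ### The modules `V(ω)` and `V(ω, J, J')` over a generalized Weyl algebra

A linear orbit `ω` is described by one of its points: the elements of the orbit of
`(τ - a, σ - b)` are the ideals `𝔪_i = α ^ i (τ - a, σ - b)` with `i : ℤ`, and `𝔪_i` is written as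
its index `i`; the order of `ω` is the order of `ℤ`. -/

section Orbit

variable {K : Type u} [Field K] (q : Kˣ) (t : BaseRing K) (a : K) (b : Kˣ)

/-- The set `B_ω` of breaks in the orbit of `(τ - a, σ - b)`. -/
def breaks : Set ℤ := {i | pt q a b i t = 0}

/-- The set `B_ω'`: the breaks and, if there is a maximal break `𝔪`, also `α(𝔪)`. -/
def breaks' : Set ℤ := breaks q t a b ∪ {i | IsGreatest (breaks q t a b) (i - 1)}

/-- The condition on the pair `J, J'`: `J` is an interval in `B_ω'`, and `J'` is a subset of `J`
which does not contain the maximal element of `J`. -/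
structure IsAdmissible (J J' : Set ℤ) : Prop where
  subset : J ⊆ breaks' q t a b
  interval : ∀ i ∈ J, ∀ k ∈ J, ∀ j ∈ breaks' q t a b, i ≤ j → j ≤ k → j ∈ J
  subset' : J' ⊆ J
  notMax : ∀ m, IsGreatest J m → m ∉ J'

variable {q t a b}

theorem IsAdmissible.subset_breaks {J J' : Set ℤ} (h : IsAdmissible q t a b J J') :
    J' ⊆ breaks q t a b := by
  intro i hi
  rcases h.subset (h.subset' hi) with hb | hb
  · exact hb
  · refine absurd hi (h.notMax i ⟨h.subset' hi, fun j hj => ?_⟩)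
    rcases h.subset hj with hj | hj
    · have := hb.2 hj
      omega
    · have := hb.unique hj
      omega

variable (q t a b)

/-- The set of indices `i` with `𝔫₀ < 𝔪_i ≤ 𝔫₁`, where `𝔫₀` is the maximal break preceding all
elements of `J` (or `-∞` if there is none), and `𝔫₁` is the maximal element of `J` if it exists and
is a break, and `+∞` otherwise. -/
def supportVJ (J : Set ℤ) : Set ℤ :=
  {i | (∀ n₀, IsGreatest {k | k ∈ breaks q t a b ∧ ∀ j ∈ J, k < j} n₀ → n₀ < i) ∧
    ∀ n₁, IsGreatest J n₁ → n₁ ∈ breaks q t a b → i ≤ n₁}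

/-- The module `V(ω)` on a linear orbit `ω` without breaks. -/
def Vomega (_h : breaks q t a b = ∅) : GChain q t where
  I := Set.univ
  a := a
  b := b
  x i := pt q a b i t
  y _ := 1
  mid _ _ _ := mul_one _
  top _ _ hi := absurd (Set.mem_univ _) hi
  bot _ _ hi := absurd (Set.mem_univ _) hi

open Classical in
/-- The module `V(ω, J, J')` on a linear orbit `ω`. (That `T` vanishes at the weight `α(𝔫₀)` is part
of the convention `v_j = 0` for `j` outside of the support.) -/
def VJ (J J' : Set ℤ) (h : IsAdmissible q t a b J J') : GChain q t where
  I := supportVJ q t a b J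
  a := a
  b := b
  x i := if i ∈ breaks q t a b then (if i ∈ J' then 1 else 0) else pt q a b i t
  y i := if i - 1 ∈ J' then 0 else 1
  mid i _ _ := by
    rw [add_sub_cancel_right]
    by_cases hi : i ∈ breaks q t a b
    · have hi' : pt q a b i t = 0 := hi
      by_cases hj : i ∈ J' <;> simp [hi, hj, hi']
    · have hj : i ∉ J' := fun hj => hi (h.subset_breaks hj)
      simp [hi, hj]
  top i hi hi' := by
    by_contra hne
    refine hi' ⟨fun n₀ hn => (hi.1 n₀ hn).trans (lt_add_one i), fun n₁ hn hb => ?_⟩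
    have h₁ := hi.2 n₁ hn hb
    have h₂ : i ≠ n₁ := by
      rintro rfl
      exact hne hb
    omega
  bot i hi hi' := by
    by_contra hne
    refine hi' ⟨fun n₀ hn => ?_, fun n₁ hn hb => ?_⟩
    · have h₁ := hi.1 n₀ hn
      have h₂ : n₀ ≠ i - 1 := by
        rintro rfl
        exact hne hn.1.1
      omega
    · have h₁ := hi.2 n₁ hn hb
      omega

end Orbit

/-! ### The explicit `D`-modules -/

section Explicit

variable {K : Type u} [Field K] (q : Kˣ)

theorem zpow_val_ne_one {q : Kˣ} (hq : ¬ IsOfFinOrder q) {i : ℤ} (hi : i ≠ 0) :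
    ((q ^ i : Kˣ) : K) - 1 ≠ 0 := by
  rw [sub_ne_zero, Ne, Units.val_eq_one]
  intro h
  exact hq (isOfFinOrder_iff_zpow_eq_one.2 ⟨i, hi, h⟩)

theorem zpow_mul_val_ne_one {q b : Kˣ} (hb : b ∉ Subgroup.zpowers q) (i : ℤ) :
    ((q ^ i * b : Kˣ) : K) - 1 ≠ 0 := by
  rw [sub_ne_zero, Ne, Units.val_eq_one]
  intro h
  exact hb ⟨-i, by simpa using inv_eq_of_mul_eq_one_right h⟩

theorem zpow_add_one_mul_inv (q : Kˣ) (i : ℤ) : q ^ (i + 1) * q⁻¹ = q ^ i := by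
  rw [zpow_add_one, mul_inv_cancel_right]

theorem zpow_mul_inv' (q : Kˣ) (i : ℤ) : q ^ i * q⁻¹ = q ^ (i - 1) := (zpow_sub_one q i).symm

/-- The `D`-module `V_q(ω, b, a)` for `b` not a power of `q`: basis `v_i`, `i ∈ ℤ`, with
`τ v_i = (a + i) v_i`, `σ v_i = q ^ i b v_i`, `X v_i = (q ^ (i+1) b - 1) v_{i+1}`,
`Y₁ v_i = v_{i-1}` and `Y v_i = (a + i - 1) / (q ^ i b - 1) v_{i-1}`. -/
def Vq (a : K) (b : Kˣ) (hb : b ∉ Subgroup.zpowers q) : DChain q where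
  I := Set.univ
  a := a
  b := b
  x i := ((q ^ (i + 1) * b : Kˣ) : K) - 1
  y i := (a + i - 1) / (((q ^ i * b : Kˣ) : K) - 1)
  z _ := 1
  midY i _ _ := by
    rw [mul_div_cancel₀ _ (zpow_mul_val_ne_one hb _)]
    push_cast
    ring
  topY _ _ h := absurd (Set.mem_univ _) h
  botY _ _ h := absurd (Set.mem_univ _) h
  midY₁ i _ _ := mul_one _
  topY₁ _ _ h := absurd (Set.mem_univ _) h
  botY₁ _ _ h := absurd (Set.mem_univ _) h
  compat i _ _ := by rw [div_mul_cancel₀ _ (zpow_mul_val_ne_one hb _), one_mul]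

/-- The `D`-module that extends `V_q(ω, {𝔪₀}, ∅)`, for `q` not a root of unity: basis `v_i`,
`i ≤ 0`, with `τ v_i = i v_i`, `σ v_i = q ^ (i-1) v_i`, `X v_i = (q ^ i - 1) v_{i+1}`
(in particular `X v_0 = 0`), `Y₁ v_i = v_{i-1}` and
`Y v_i = (i - 1) / (q ^ (i-1) - 1) v_{i-1}`. -/
def VqNeg (hq : ¬ IsOfFinOrder q) : DChain q where
  I := Set.Iic 0
  a := 0
  b := q⁻¹
  x i := ((q ^ i : Kˣ) : K) - 1
  y i := ((i : K) - 1) / (((q ^ (i - 1) : Kˣ) : K) - 1)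
  z _ := 1
  midY i _ h := by
    have hi : i ≠ 0 := by
      rintro rfl
      simp at h
    rw [add_sub_cancel_right, mul_div_cancel₀ _ (zpow_val_ne_one hq hi)]
    push_cast
    ring
  topY i h h' := by
    have hi : i = 0 := by
      simp only [Set.mem_Iic] at h h'
      omega
    simp [hi]
  botY i h h' := by
    simp only [Set.mem_Iic] at h h'
    omega
  midY₁ i _ _ := by rw [zpow_add_one_mul_inv, mul_one]
  topY₁ i h h' := by
    have hi : i = 0 := by
      simp only [Set.mem_Iic] at h h'
      omega
    simp [hi]
  botY₁ i h h' := by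
    simp only [Set.mem_Iic] at h h'
    omega
  compat i h _ := by
    have hi : i - 1 ≠ 0 := by
      simp only [Set.mem_Iic] at h
      omega
    rw [zpow_mul_inv', div_mul_cancel₀ _ (zpow_val_ne_one hq hi)]
    ring

/-- The `D`-module that extends `V_q(ω, {𝔪₁}, ∅)`, for `q` not a root of unity: basis `v_i`,
`i ≥ 1`, with `τ v_i = i v_i`, `σ v_i = q ^ (i-1) v_i`, `X v_i = (q ^ i - 1) v_{i+1}`,
`Y₁ v_i = v_{i-1}` and `Y v_i = (i - 1) / (q ^ (i-1) - 1) v_{i-1}` for `i ≥ 2`, and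
`Y v_1 = Y₁ v_1 = 0`. -/
def VqPos (hq : ¬ IsOfFinOrder q) : DChain q where
  I := Set.Ici 1
  a := 0
  b := q⁻¹
  x i := ((q ^ i : Kˣ) : K) - 1
  y i := ((i : K) - 1) / (((q ^ (i - 1) : Kˣ) : K) - 1)
  z _ := 1
  midY i h _ := by
    have hi : i ≠ 0 := by
      rintro rfl
      simp at h
    rw [add_sub_cancel_right, mul_div_cancel₀ _ (zpow_val_ne_one hq hi)]
    push_cast
    ring
  topY i h h' := by
    simp only [Set.mem_Ici] at h h'
    omega
  botY i h h' := by
    have hi : i = 1 := by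
      simp only [Set.mem_Ici] at h h'
      omega
    simp [hi]
  midY₁ i _ _ := by rw [zpow_add_one_mul_inv, mul_one]
  topY₁ i h h' := by
    simp only [Set.mem_Ici] at h h'
    omega
  botY₁ i h h' := by
    have hi : i = 1 := by
      simp only [Set.mem_Ici] at h h'
      omega
    simp [hi]
  compat i _ h := by
    have hi : i - 1 ≠ 0 := by
      simp only [Set.mem_Ici] at h
      omega
    rw [zpow_mul_inv', div_mul_cancel₀ _ (zpow_val_ne_one hq hi)]
    ring

/-- The `D`-module `V_1(ω, a, b)` for `a` not an integer: basis `v_i`, `i ∈ ℤ`, with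
`τ v_i = (a + i) v_i`, `σ v_i = q ^ i b v_i`, `X v_i = (a + i) v_{i+1}`, `Y v_i = v_{i-1}` and
`Y₁ v_i = (q ^ i b - 1) / (a + i - 1) v_{i-1}`. -/
def V1 (a : K) (b : Kˣ) (ha : ∀ n : ℤ, a ≠ n) : DChain q where
  I := Set.univ
  a := a
  b := b
  x i := a + i
  y _ := 1
  z i := (((q ^ i * b : Kˣ) : K) - 1) / (a + i - 1)
  midY i _ _ := mul_one _
  topY _ _ h := absurd (Set.mem_univ _) h
  botY _ _ h := absurd (Set.mem_univ _) h
  midY₁ i _ _ := by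
    have h : a + i ≠ 0 := fun h => ha (-i) (by push_cast; linear_combination h)
    have e : a + ((i + 1 : ℤ) : K) - 1 = a + i := by push_cast; ring
    rw [e, mul_div_cancel₀ _ h]
  topY₁ _ _ h := absurd (Set.mem_univ _) h
  botY₁ _ _ h := absurd (Set.mem_univ _) h
  compat i _ _ := by
    have h : a + i - 1 ≠ 0 := fun h => ha (1 - i) (by push_cast; linear_combination h)
    rw [div_mul_cancel₀ _ h, one_mul]

section CharZero

variable [CharZero K]

/-- The `D`-module that extends `V_1(ω, {𝔪₀}, ∅)`: basis `v_i`, `i ≤ 0`, with `τ v_i = i v_i`,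
`σ v_i = q ^ (i-1) v_i`, `X v_i = i v_{i+1}` (in particular `X v_0 = 0`), `Y v_i = v_{i-1}` and
`Y₁ v_i = (q ^ (i-1) - 1) / (i - 1) v_{i-1}`. -/
def V1Neg : DChain q where
  I := Set.Iic 0
  a := 0
  b := q⁻¹
  x i := i
  y _ := 1
  z i := (((q ^ (i - 1) : Kˣ) : K) - 1) / ((i : K) - 1)
  midY _ _ _ := by simp
  topY i h h' := by
    have hi : i = 0 := by
      simp only [Set.mem_Iic] at h h'
      omega
    simp [hi]
  botY i h h' := by
    simp only [Set.mem_Iic] at h h'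
    omega
  midY₁ i _ h := by
    have hi : (i : K) ≠ 0 := by
      rw [Int.cast_ne_zero]
      rintro rfl
      simp at h
    have e : ((i + 1 : ℤ) : K) - 1 = i := by push_cast; ring
    rw [zpow_add_one_mul_inv, add_sub_cancel_right, e, mul_div_cancel₀ _ hi]
  topY₁ i h h' := by
    have hi : i = 0 := by
      simp only [Set.mem_Iic] at h h'
      omega
    simp [hi]
  botY₁ i h h' := by
    simp only [Set.mem_Iic] at h h'
    omega
  compat i h _ := by
    have hi : ((i - 1 : ℤ) : K) ≠ 0 := by
      rw [Int.cast_ne_zero]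
      simp only [Set.mem_Iic] at h
      omega
    rw [Int.cast_sub, Int.cast_one] at hi
    rw [zpow_mul_inv', zero_add, div_mul_cancel₀ _ hi, one_mul]

/-- The `D`-module that extends `V_1(ω, {𝔪₁}, ∅)`: basis `v_i`, `i ≥ 1`, with `τ v_i = i v_i`,
`σ v_i = q ^ (i-1) v_i`, `X v_i = i v_{i+1}`, `Y v_i = v_{i-1}` and
`Y₁ v_i = (q ^ (i-1) - 1) / (i - 1) v_{i-1}` for `i ≥ 2`, and `Y v_1 = Y₁ v_1 = 0`. -/
def V1Pos : DChain q where
  I := Set.Ici 1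
  a := 0
  b := q⁻¹
  x i := i
  y _ := 1
  z i := (((q ^ (i - 1) : Kˣ) : K) - 1) / ((i : K) - 1)
  midY _ _ _ := by simp
  topY i h h' := by
    simp only [Set.mem_Ici] at h h'
    omega
  botY i h h' := by
    have hi : i = 1 := by
      simp only [Set.mem_Ici] at h h'
      omega
    simp [hi]
  midY₁ i h _ := by
    have hi : (i : K) ≠ 0 := by
      rw [Int.cast_ne_zero]
      rintro rfl
      simp at h
    have e : ((i + 1 : ℤ) : K) - 1 = i := by push_cast; ring
    rw [zpow_add_one_mul_inv, add_sub_cancel_right, e, mul_div_cancel₀ _ hi]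
  topY₁ i h h' := by
    simp only [Set.mem_Ici] at h h'
    omega
  botY₁ i h h' := by
    have hi : i = 1 := by
      simp only [Set.mem_Ici] at h h'
      omega
    simp [hi]
  compat i _ h := by
    have hi : ((i - 1 : ℤ) : K) ≠ 0 := by
      rw [Int.cast_ne_zero]
      simp only [Set.mem_Ici] at h
      omega
    rw [Int.cast_sub, Int.cast_one] at hi
    rw [zpow_mul_inv', zero_add, div_mul_cancel₀ _ hi, one_mul]

/-- The `D`-module `V_1(ω, J, J', b)` that extends `V_1(ω, {𝔪₀, 𝔪₁}, {𝔪₀})`: basis `v_i`,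
`i ∈ ℤ`, with `τ v_i = i v_i`, `σ v_i = q ^ i b v_i`, `X v_0 = v_1`, `X v_i = i v_{i+1}` for
`i ≠ 0`, `Y v_1 = 0`, `Y v_i = v_{i-1}` for `i ≠ 1`, `Y₁ v_1 = (q b - 1) v_0` and
`Y₁ v_i = (q ^ i b - 1) / (i - 1) v_{i-1}` for `i ≠ 1`. -/
def V1Full (b : Kˣ) : DChain q where
  I := Set.univ
  a := 0
  b := b
  x i := if i = 0 then 1 else i
  y i := if i = 1 then 0 else 1
  z i := if i = 1 then ((q * b : Kˣ) : K) - 1 else (((q ^ i * b : Kˣ) : K) - 1) / ((i : K) - 1)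
  midY i _ _ := by by_cases hi : i = 0 <;> simp [hi]
  topY _ _ h := absurd (Set.mem_univ _) h
  botY _ _ h := absurd (Set.mem_univ _) h
  midY₁ i _ _ := by
    by_cases hi : i = 0
    · simp [hi]
    · have hi' : (i : K) ≠ 0 := Int.cast_ne_zero.2 hi
      have e : ((i + 1 : ℤ) : K) - 1 = i := by push_cast; ring
      rw [if_neg hi, if_neg (by omega), e, mul_div_cancel₀ _ hi']
  topY₁ _ _ h := absurd (Set.mem_univ _) h
  botY₁ _ _ h := absurd (Set.mem_univ _) h
  compat i _ _ := by
    by_cases hi : i = 1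
    · simp [hi]
    · have hi' : ((i - 1 : ℤ) : K) ≠ 0 := Int.cast_ne_zero.2 (by omega)
      rw [Int.cast_sub, Int.cast_one] at hi'
      rw [if_neg hi, if_neg hi, zero_add, div_mul_cancel₀ _ hi', one_mul]

/-- The `D`-module `V_1(ω, J, J', c, d)` on the orbit of `(τ, σ - q⁻¹)`: basis `v_i`, `i ∈ ℤ`, with
`τ v_i = i v_i`, `σ v_i = q ^ (i-1) v_i`, `X v_i = i v_{i+1}`, `Y v_1 = c v_0`, `Y v_i = v_{i-1}`
for `i ≠ 1`, `Y₁ v_1 = d v_0` and `Y₁ v_i = (q ^ (i-1) - 1) / (i - 1) v_{i-1}` for `i ≠ 1`. -/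
def V1Two (c d : K) : DChain q where
  I := Set.univ
  a := 0
  b := q⁻¹
  x i := i
  y i := if i = 1 then c else 1
  z i := if i = 1 then d else (((q ^ (i - 1) : Kˣ) : K) - 1) / ((i : K) - 1)
  midY i _ _ := by by_cases hi : i = 0 <;> simp [hi]
  topY _ _ h := absurd (Set.mem_univ _) h
  botY _ _ h := absurd (Set.mem_univ _) h
  midY₁ i _ _ := by
    by_cases hi : i = 0
    · simp [hi]
    · have hi' : (i : K) ≠ 0 := Int.cast_ne_zero.2 hi
      have e : ((i + 1 : ℤ) : K) - 1 = i := by push_cast; ring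
      rw [if_neg (by omega), e, add_sub_cancel_right, mul_div_cancel₀ _ hi', zpow_add_one_mul_inv]
  topY₁ _ _ h := absurd (Set.mem_univ _) h
  botY₁ _ _ h := absurd (Set.mem_univ _) h
  compat i _ _ := by
    by_cases hi : i = 1
    · simp [hi]
    · have hi' : ((i - 1 : ℤ) : K) ≠ 0 := Int.cast_ne_zero.2 (by omega)
      rw [Int.cast_sub, Int.cast_one] at hi'
      rw [if_neg hi, if_neg hi, zero_add, zpow_mul_inv', div_mul_cancel₀ _ hi', one_mul]

end CharZero

end Explicit

/-! ### Weight modules, indecomposability, and the three families -/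

section Families

/-- A module over a ring is indecomposable if it is nonzero and is not the direct sum of two nonzero
submodules. -/
def IsIndecomposable (A : Type*) [Ring A] (V : Type*) [AddCommGroup V] [Module A V] : Prop :=
  Nontrivial V ∧ ∀ W₁ W₂ : Submodule A V, IsCompl W₁ W₂ → W₁ = ⊥ ∨ W₂ = ⊥

variable {K : Type u} [Field K] (q : Kˣ) (V : Type v) [AddCommGroup V] [Module K V]
  [Module (D K q) V] [IsScalarTower K (D K q) V]

/-- The weight space `V_𝔪 = {v ∈ V | 𝔪 v = 0}`. -/
def weightSpace (𝔪 : Ideal (BaseRing K)) : Submodule K V where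
  carrier := {v | ∀ r ∈ 𝔪, D.coef K q r • v = 0}
  add_mem' hv hw r hr := by rw [smul_add, hv r hr, hw r hr, add_zero]
  zero_mem' r _ := smul_zero _
  smul_mem' c v hv r hr := by rw [← smul_comm c, hv r hr, smul_zero]

/-- `V` is a weight module: it is the sum of its weight spaces `V_𝔪`, `𝔪 ∈ Max(R)`. -/
def IsWeightModule : Prop :=
  ⨆ 𝔪 : MaximalSpectrum (BaseRing K), weightSpace q V 𝔪.asIdeal = ⊤

/-- `V` is an irreducible `D` weight module. -/
def IsIrreducibleWeight : Prop := IsSimpleModule (D K q) V ∧ IsWeightModule q V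

/-- The restriction of the `D`-module `V` to `A_q` is isomorphic to `W`, that is, `V` extends `W`. -/
def ExtendsAq (W : GChain q (kappa q)) : Prop :=
  ∃ e : V ≃ₗ[K] W.Mod, ∀ (g : GWA K q (kappa q)) (v : V), e (toAq K q g • v) = g • e v

/-- The restriction of the `D`-module `V` to `A_1` is isomorphic to `W`, that is, `V` extends `W`. -/
def ExtendsA1 (W : GChain q (tau K)) : Prop :=
  ∃ e : V ≃ₗ[K] W.Mod, ∀ (g : GWA K q (tau K)) (v : V), e (toA1 K q g • v) = g • e v

/-- Family I: irreducible `D` weight modules extended from irreducible `A_q` weight modules. -/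
def FamilyI : Prop := IsIrreducibleWeight q V ∧ IsSimpleModule (Aq K q) V

/-- Family II: irreducible `D` weight modules extended from irreducible `A_1` weight modules. -/
def FamilyII : Prop := IsIrreducibleWeight q V ∧ IsSimpleModule (A1 K q) V

/-- Family III: irreducible `D` weight modules which are indecomposable but not irreducible both over
`A_q` and over `A_1`, and which extend an `A_q`-module `V_q(ω, J, J')` and an `A_1`-module
`V_1(ω, J, J')` on an orbit with breaks. -/
def FamilyIII : Prop :=
  IsIrreducibleWeight q V ∧
  (IsIndecomposable (Aq K q) V ∧ ¬ IsSimpleModule (Aq K q) V) ∧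
  (IsIndecomposable (A1 K q) V ∧ ¬ IsSimpleModule (A1 K q) V) ∧
  ∃ (a : K) (b : Kˣ),
    ((breaks q (kappa q) a b).Nonempty ∧
      ∃ (J J' : Set ℤ) (h : IsAdmissible q (kappa q) a b J J'),
        ExtendsAq q V (VJ q (kappa q) a b J J' h)) ∧
    ((breaks q (tau K) a b).Nonempty ∧
      ∃ (J J' : Set ℤ) (h : IsAdmissible q (tau K) a b J J'),
        ExtendsA1 q V (VJ q (tau K) a b J J' h))

/-- `V` is isomorphic to a `D`-module in the explicit list of Family I. -/
def ListI : Prop :=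
  (∃ (a : K) (b : Kˣ) (hb : b ∉ Subgroup.zpowers q), Nonempty (V ≃ₗ[D K q] (Vq q a b hb).Mod)) ∨
  ∃ hq : ¬ IsOfFinOrder q,
    Nonempty (V ≃ₗ[D K q] (VqNeg q hq).Mod) ∨ Nonempty (V ≃ₗ[D K q] (VqPos q hq).Mod)

/-- `V` is isomorphic to a `D`-module in the explicit list of Family II. -/
def ListII [CharZero K] : Prop :=
  (∃ (a : K) (b : Kˣ) (ha : ∀ n : ℤ, a ≠ n), Nonempty (V ≃ₗ[D K q] (V1 q a b ha).Mod)) ∨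
  Nonempty (V ≃ₗ[D K q] (V1Neg q).Mod) ∨ Nonempty (V ≃ₗ[D K q] (V1Pos q).Mod)

/-- `V` is isomorphic to a `D`-module in the explicit list of Family III. -/
def ListIII [CharZero K] : Prop :=
  ∃ b : Kˣ, b ∈ Subgroup.zpowers q ∧ b ≠ q⁻¹ ∧ Nonempty (V ≃ₗ[D K q] (V1Full q b).Mod)

end Families

end QDiff

end

open QDiff

noncomputable section

namespace QDiff

/-! ### Sequences indexed by the integers -/

/-! The whole classification rests on one normalization: rescale the weight basis so that `X w_i =
w_{i+1}`. Then `Y X = τ` and `Y₁ X = qσ - 1` force `Y w_{i+1} = (a + i) w_i` and `Y₁ w_{i+1} =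
(q^{i+1} b - 1) w_i`, so the module is determined by its support `I` and the point `(a, b)`. This is
`IsWeightFamily`. In characteristic 0 the eigenvalues `a + i` of `τ` are distinct, hence such
vectors form a basis.

Existence. Start from a weight vector of an irreducible `V`; it lies over a point `(a, b)` by the
Nullstellensatz. Going up, apply `X`; going down, divide by `X`, which is possible as soon as one of
`a + i`, `q^{i+1} b - 1` is nonzero, the relation between `Y` and `Y₁` keeping the two lowering
operators consistent (`HasWeight.exists_X_smul_eq`). Without a common zero this gives a family along
the whole orbit. A common zero is unique; put it at index 0, so `a = 0`, `b = q⁻¹`. No composite of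
`X` with `Y` or `Y₁` crosses the gap between 0 and 1, and irreducibility leaves only the half lines
`i ≤ 0` and `i ≥ 1`. This is `IsIrreducibleWeight.exists_isWeightFamily`.

Irreducibility. An `R`-stable subspace contains a basis vector as soon as it is nonzero, and `X`
moves it up. So the module is simple exactly when every inner step can be undone by an available
lowering operator (`noStableSubspace_iff`): `q^{i+1} b ≠ 1` over `A_q`, `a + i ≠ 0` over `A_1`, one
of the two over `D`. On a whole orbit this reads `b ∉ ⟨q⟩`, `a ∉ ℤ`, and no common zero. If the
first two fail, a shift gives `a = 0` and `b ∈ ⟨q⟩`, and irreducibility over `D` becomes `b ≠ q⁻¹`: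
Family III. Half lines are always simple over `A_1`, and over `A_q` exactly when `q` is not a root
of unity.

Comparison with the explicit modules. Apart from `V1Two`, no inner `X`-arrow of an explicit module
vanishes, so rescaling by the cumulative products of its `X`-coefficients puts it in normal form
(`DChain.exists_isWeightFamily`), and conversely normal forms map onto the explicit modules
(`nonempty_equiv`, `extendsAq`, `extendsA1`). `V1Two` has a vanishing inner arrow, which yields a
proper submodule. -/

theorem exists_int_seq {α : Type*} (P : ℤ → α → Prop) (Rel : ℤ → α → α → Prop) (m : ℤ) (v : α)
    (hv : P m v) (up : ∀ i, m ≤ i → ∀ u, P i u → ∃ u', P (i + 1) u' ∧ Rel i u u')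
    (down : ∀ i, i < m → ∀ u', P (i + 1) u' → ∃ u, P i u ∧ Rel i u u') :
    ∃ w : ℤ → α, w m = v ∧ (∀ i, P i (w i)) ∧ ∀ i, Rel i (w i) (w (i + 1)) := by
  choose f hf hf' using up
  choose g hg hg' using down
  -- The upward and downward halves are separate recursions, with values in subtypes so that `P` at
  -- each stage feeds the next choice; they are glued at `m`.
  let F : (n : ℕ) → {u // P (m + n) u} := fun n => Nat.rec ⟨v, by simpa using hv⟩
    (fun n u => ⟨f (m + n) (by omega) u.1 u.2, by
      have := hf (m + n) (by omega) u.1 u.2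
      rwa [add_assoc] at this⟩) n
  let G : (n : ℕ) → {u // P (m - n) u} := fun n => Nat.rec ⟨v, by simpa using hv⟩
    (fun n u => ⟨g (m - (n + 1 : ℕ)) (by omega) u.1
      (by have := u.2; rwa [show m - ((n + 1 : ℕ) : ℤ) + 1 = m - n by push_cast; ring]),
      hg _ _ _ _⟩) n
  have hF : ∀ n : ℕ, Rel (m + n) (F n).1 (F (n + 1)).1 := fun n =>
    hf' (m + n) (by omega) (F n).1 (F n).2
  have hG : ∀ n : ℕ, Rel (m - (n + 1 : ℕ)) (G (n + 1)).1 (G n).1 := fun n =>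
    hg' (m - (n + 1 : ℕ)) (by omega) (G n).1 _
  have h0 : (F 0).1 = (G 0).1 := rfl
  -- The subtype depends on the index, so equal indices are transported only after passing to
  -- underlying values.
  have eF : ∀ {k n : ℕ}, k = n → (F k).1 = (F n).1 := by
    rintro k _ rfl
    rfl
  have eG : ∀ {k n : ℕ}, k = n → (G k).1 = (G n).1 := by
    rintro k _ rfl
    rfl
  let w : ℤ → α := fun i => if m ≤ i then (F (i - m).toNat).1 else (G (m - i).toNat).1
  have wF : ∀ n : ℕ, w (m + n) = (F n).1 := fun n => by
    simp only [w]
    rw [if_pos (by omega), eF (show (m + n - m).toNat = n by omega)]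
  have wG : ∀ n : ℕ, w (m - n) = (G n).1 := fun n => by
    rcases Nat.eq_zero_or_pos n with rfl | hn
    · simpa [h0] using wF 0
    · simp only [w]
      rw [if_neg (by omega), eG (show (m - (m - n)).toNat = n by omega)]
  refine ⟨w, (congrArg w (by simp)).trans (wF 0), fun i => ?_, fun i => ?_⟩
  · rcases le_total m i with h | h
    · obtain ⟨n, rfl⟩ := Int.le.dest h
      rw [wF]
      exact (F n).2
    · obtain ⟨n, hn⟩ := Int.le.dest h
      obtain rfl : i = m - n := by omega
      rw [wG]
      exact (G n).2
  · rcases le_or_gt m i with h | h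
    · obtain ⟨n, rfl⟩ := Int.le.dest h
      have := hF n
      rwa [← wF, ← wF, Nat.cast_succ, ← add_assoc] at this
    · obtain ⟨n, hn⟩ := Int.le.dest (Int.add_one_le_of_lt h)
      have := hG n
      rw [← wG, ← wG] at this
      rwa [show m - ((n + 1 : ℕ) : ℤ) = i by omega, show m - (n : ℤ) = i + 1 by omega] at this

/-- Cumulative products of `x`, restarted at 1 wherever `x` vanishes. If `X v_i = x(i) v_{i+1}`,
then `w_i = c(i) v_i` satisfies `X w_i = w_{i+1}` across every nonzero arrow. -/
theorem exists_int_scaling {K : Type*} [Field K] (x : ℤ → K) :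
    ∃ c : ℤ → K, (∀ i, c i ≠ 0) ∧ ∀ i, x i ≠ 0 → c (i + 1) = x i * c i := by
  obtain ⟨c, -, hc, hc'⟩ := exists_int_seq (fun _ (c : K) => c ≠ 0)
    (fun i c c' => x i ≠ 0 → c' = x i * c) 0 1 one_ne_zero
    (fun i _ c hc => by
      by_cases h : x i = 0
      · exact ⟨1, one_ne_zero, fun h' => absurd h h'⟩
      · exact ⟨x i * c, mul_ne_zero h hc, fun _ => rfl⟩)
    (fun i _ c hc => by
      by_cases h : x i = 0
      · exact ⟨1, one_ne_zero, fun h' => absurd h h'⟩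
      · exact ⟨(x i)⁻¹ * c, mul_ne_zero (inv_ne_zero h) hc, fun _ => by field_simp⟩)
  exact ⟨c, hc, hc'⟩

/-- All indices between `m` and `i` stay in `I`, so an equivalence between neighbours inside `I` is
enough to propagate both ways. -/
theorem ordConnected_int_induction {I : Set ℤ} (hI : I.OrdConnected) {Q : ℤ → Prop}
    (hQ : ∀ i, i ∈ I → i + 1 ∈ I → (Q i ↔ Q (i + 1))) {m : ℤ} (hm : m ∈ I) (h : Q m) :
    ∀ i ∈ I, Q i := by
  intro i hi
  rcases le_total m i with hmi | hmi
  · obtain ⟨n, rfl⟩ := Int.le.dest hmi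
    clear hmi
    induction n with
    | zero => simpa using h
    | succ n ih =>
      have hn : m + n ∈ I := hI.out hm hi ⟨by omega, by omega⟩
      rw [Nat.cast_succ, ← add_assoc] at hi ⊢
      exact (hQ _ hn hi).1 (ih hn)
  · obtain ⟨n, hn⟩ := Int.le.dest hmi
    obtain rfl : i = m - n := by omega
    clear hmi hn
    induction n with
    | zero => simpa using h
    | succ n ih =>
      have hn : m - n ∈ I := hI.out hi hm ⟨by omega, by omega⟩
      have e : m - (n : ℤ) = m - ((n + 1 : ℕ) : ℤ) + 1 := by push_cast; ring
      have := ih hn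
      rw [e] at this hn
      exact (hQ _ hi hn).2 this

/-! ### Generation of the algebras -/

section Generation

variable {K : Type u} [Field K] {q : Kˣ}

theorem adjoin_gen_eq_top :
    Algebra.adjoin K (Set.range (D.coef K q) ∪ {D.X K q, D.Y K q, D.Y₁ K q}) = ⊤ := by
  rw [Algebra.eq_top_iff]
  intro g
  obtain ⟨x, rfl⟩ := RingQuot.mkAlgHom_surjective K _ g
  induction x using FreeAlgebra.induction with
  | grade0 c => simp
  | grade1 g =>
    cases g with
    | coef r => exact Algebra.subset_adjoin (Or.inl ⟨r, rfl⟩)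
    | X => exact Algebra.subset_adjoin (Or.inr (Or.inl rfl))
    | Y => exact Algebra.subset_adjoin (Or.inr (Or.inr (Or.inl rfl)))
    | Y₁ => exact Algebra.subset_adjoin (Or.inr (Or.inr (Or.inr rfl)))
  | mul a b ha hb => simpa using mul_mem ha hb
  | add a b ha hb => simpa using add_mem ha hb

/-- Over a subalgebra generated by `s`, a property of elements of the module algebra that is stable
under the operations holds as soon as it holds on `s`. -/
theorem smul_mem_of_mem_adjoin {V : Type v} [AddCommGroup V] [Module K V] [Module (D K q) V]
    [IsScalarTower K (D K q) V] {s : Set (D K q)} {N : Submodule K V}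
    (hN : ∀ g ∈ s, ∀ v ∈ N, g • v ∈ N) {g : D K q} (hg : g ∈ Algebra.adjoin K s) :
    ∀ v ∈ N, g • v ∈ N := by
  induction hg using Algebra.adjoin_induction with
  | mem g hg => exact hN g hg
  | algebraMap c =>
    intro v hv
    rw [algebraMap_smul]
    exact N.smul_mem c hv
  | add g h _ _ hg hh =>
    intro v hv
    rw [add_smul]
    exact N.add_mem (hg v hv) (hh v hv)
  | mul g h _ _ hg hh =>
    intro v hv
    rw [mul_smul]
    exact hg _ (hh v hv)

theorem map_smul_of_gen {V W : Type*} [AddCommGroup V] [Module K V] [Module (D K q) V]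
    [IsScalarTower K (D K q) V] [AddCommGroup W] [Module K W] [Module (D K q) W]
    [IsScalarTower K (D K q) W] (e : V →ₗ[K] W)
    (hc : ∀ r v, e (D.coef K q r • v) = D.coef K q r • e v)
    (hX : ∀ v, e (D.X K q • v) = D.X K q • e v)
    (hY : ∀ v, e (D.Y K q • v) = D.Y K q • e v)
    (hY₁ : ∀ v, e (D.Y₁ K q • v) = D.Y₁ K q • e v) (g : D K q) (v : V) :
    e (g • v) = g • e v := by
  have hg : g ∈ Algebra.adjoin K (Set.range (D.coef K q) ∪ {D.X K q, D.Y K q, D.Y₁ K q}) := by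
    rw [adjoin_gen_eq_top]
    trivial
  induction hg using Algebra.adjoin_induction generalizing v with
  | mem g hg =>
    rcases hg with ⟨r, rfl⟩ | rfl | rfl | rfl
    · exact hc r v
    · exact hX v
    · exact hY v
    · exact hY₁ v
  | algebraMap c => rw [algebraMap_smul, algebraMap_smul, map_smul]
  | add g h _ _ hg hh => rw [add_smul, add_smul, map_add, hg, hh]
  | mul g h _ _ hg hh => rw [mul_smul, mul_smul, hg, hh]

/-- A linear map from the restriction of a `D`-module along `φ` to a module over a generalized Weyl
algebra is equivariant if it commutes with the generators. -/
theorem map_smul_of_ggen {t : BaseRing K} {V : Type*} [AddCommGroup V] [Module K V]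
    [Module (D K q) V] [IsScalarTower K (D K q) V] (φ : GWA K q t →ₐ[K] D K q) (W : GChain q t)
    (e : V →ₗ[K] W.Mod)
    (h : ∀ x v, e (φ (RingQuot.mkAlgHom K _ (FreeAlgebra.ι K x)) • v) =
      W.rep (RingQuot.mkAlgHom K _ (FreeAlgebra.ι K x)) (e v)) (g : GWA K q t) (v : V) :
    e (φ g • v) = g • e v := by
  obtain ⟨x, rfl⟩ := RingQuot.mkAlgHom_surjective K _ g
  rw [GChain.smul_def]
  induction x using FreeAlgebra.induction generalizing v with
  | grade0 c =>
    rw [AlgHom.commutes, AlgHom.commutes, AlgHom.commutes, algebraMap_smul, map_smul]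
    rfl
  | grade1 x => exact h x v
  | mul a b ha hb => rw [map_mul, map_mul, map_mul, mul_smul, ha, hb]; rfl
  | add a b ha hb => rw [map_add, map_add, map_add, add_smul, map_add, ha, hb]; rfl

end Generation

/-! ### Weight bases normalized by `X v_i = v_{i+1}` -/

section WeightFamily

variable {K : Type u} [Field K]

/-- The vectors `w i`, `i ∈ I`, form a basis of `V`, `w i` has weight `(τ - a - i, σ - q ^ i b)`,
and `X w_i = w_{i+1}`, `Y w_{i+1} = (a + i) w_i`, `Y₁ w_{i+1} = (q ^ (i+1) b - 1) w_i`, where `w i`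
is `0` for `i ∉ I`. In characteristic `0` linear independence follows from the conditions
listed. -/
structure IsWeightFamily (q : Kˣ) {V : Type v} [AddCommGroup V] [Module K V] [Module (D K q) V]
    (I : Set ℤ) (a : K) (b : Kˣ) (w : ℤ → V) : Prop where
  zero : ∀ i ∉ I, w i = 0
  ne : ∀ i ∈ I, w i ≠ 0
  coef : ∀ i r, D.coef K q r • w i = pt q a b i r • w i
  X : ∀ i ∈ I, D.X K q • w i = w (i + 1)
  Y : ∀ i, D.Y K q • w (i + 1) = (a + i) • w i
  Y₁ : ∀ i, D.Y₁ K q • w (i + 1) = (((q ^ (i + 1) * b : Kˣ) : K) - 1) • w i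
  span : Submodule.span K (Set.range w) = ⊤

/-- The extension by zero of the scaled standard basis. -/
def scaledSingle (I : Set ℤ) (c : ℤ → K) (i : ℤ) : I →₀ K := by
  classical
  exact if h : i ∈ I then Finsupp.single ⟨i, h⟩ (c i) else 0

theorem scaledSingle_of_mem {I : Set ℤ} (c : ℤ → K) {i : ℤ} (h : i ∈ I) :
    scaledSingle I c i = Finsupp.single ⟨i, h⟩ (c i) := dif_pos h

theorem scaledSingle_of_notMem {I : Set ℤ} (c : ℤ → K) {i : ℤ} (h : i ∉ I) :
    scaledSingle I c i = 0 := dif_neg h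

theorem span_scaledSingle (I : Set ℤ) {c : ℤ → K} (hc : ∀ i, c i ≠ 0) :
    Submodule.span K (Set.range (scaledSingle I c)) = ⊤ := by
  rw [eq_top_iff, ← Finsupp.basisSingleOne.span_eq, Submodule.span_le]
  rintro _ ⟨⟨i, hi⟩, rfl⟩
  have h : Finsupp.single ⟨i, hi⟩ (1 : K) = (c i)⁻¹ • scaledSingle I c i := by
    rw [scaledSingle_of_mem _ hi, Finsupp.smul_single, smul_eq_mul, inv_mul_cancel₀ (hc i)]
  rw [Finsupp.coe_basisSingleOne]
  change Finsupp.single _ _ ∈ _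
  rw [h]
  exact Submodule.smul_mem _ _ (Submodule.subset_span ⟨i, rfl⟩)

/-- The result is again an extension by zero, which spares later arguments a case split on `i + s ∈
I`. -/
theorem shiftOp_scaledSingle {I : Set ℤ} (s : ℤ) (f c : ℤ → K) {i : ℤ} (hi : i ∈ I) :
    shiftOp I s f (scaledSingle I c i) =
      scaledSingle I (fun j => f (j - s) * c (j - s)) (i + s) := by
  rw [scaledSingle_of_mem _ hi]
  by_cases h : i + s ∈ I
  · rw [shiftOp_single_of_mem _ _ _ _ _ h, scaledSingle_of_mem _ h, add_sub_cancel_right]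
  · rw [shiftOp_single_of_notMem _ _ _ _ _ h, scaledSingle_of_notMem _ h]

theorem weightOp_scaledSingle (q : Kˣ) (a : K) (b : Kˣ) (I : Set ℤ) (c : ℤ → K) (i : ℤ)
    (r : BaseRing K) :
    weightOp q a b I r (scaledSingle I c i) = pt q a b i r • scaledSingle I c i := by
  by_cases h : i ∈ I
  · rw [scaledSingle_of_mem _ h, weightOp_single, Finsupp.smul_single, smul_eq_mul]
  · rw [scaledSingle_of_notMem _ h, map_zero, smul_zero]

theorem smul_scaledSingle (I : Set ℤ) (k : K) (c : ℤ → K) (i : ℤ) :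
    k • scaledSingle I c i = scaledSingle I (fun j => k * c j) i := by
  by_cases h : i ∈ I
  · rw [scaledSingle_of_mem _ h, scaledSingle_of_mem _ h, Finsupp.smul_single, smul_eq_mul]
  · rw [scaledSingle_of_notMem _ h, scaledSingle_of_notMem _ h, smul_zero]

theorem scaledSingle_congr (I : Set ℤ) {c c' : ℤ → K} {i : ℤ} (h : i ∈ I → c i = c' i) :
    scaledSingle I c i = scaledSingle I c' i := by
  by_cases hi : i ∈ I
  · rw [scaledSingle_of_mem _ hi, scaledSingle_of_mem _ hi, h hi]
  · rw [scaledSingle_of_notMem _ hi, scaledSingle_of_notMem _ hi]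

theorem scaledSingle_ne_zero {I : Set ℤ} {c : ℤ → K} (hc : ∀ i, c i ≠ 0) {i : ℤ} (h : i ∈ I) :
    scaledSingle I c i ≠ 0 := by
  rw [scaledSingle_of_mem _ h]
  simpa using hc i

theorem shiftOp_up_scaledSingle {I : Set ℤ} {x c : ℤ → K}
    (hc : ∀ i ∈ I, i + 1 ∈ I → c (i + 1) = x i * c i) {i : ℤ} (hi : i ∈ I) :
    shiftOp I 1 x (scaledSingle I c i) = scaledSingle I c (i + 1) := by
  rw [shiftOp_scaledSingle _ _ _ hi]
  refine scaledSingle_congr I fun h => ?_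
  rw [add_sub_cancel_right, hc i hi h]

/-- In the scaled basis only the product `x(i) y(i+1)` is visible, since `y(i+1) c(i+1) = x(i)
y(i+1) c(i)`. At an upper end of `I` the left side is zero, and `top` makes the right side vanish
too; at a lower end both sides are zero by convention. -/
theorem shiftOp_down_scaledSingle {I : Set ℤ} {x y c p : ℤ → K}
    (hc : ∀ i ∈ I, i + 1 ∈ I → c (i + 1) = x i * c i)
    (mid : ∀ i ∈ I, i + 1 ∈ I → x i * y (i + 1) = p i)
    (top : ∀ i ∈ I, i + 1 ∉ I → p i = 0) (i : ℤ) :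
    shiftOp I (-1) y (scaledSingle I c (i + 1)) = p i • scaledSingle I c i := by
  by_cases h : i + 1 ∈ I
  · rw [shiftOp_scaledSingle _ _ _ h, smul_scaledSingle, add_neg_cancel_right]
    refine scaledSingle_congr I fun hi => ?_
    rw [sub_neg_eq_add, hc i hi h, ← mid i hi h]
    ring
  · rw [scaledSingle_of_notMem _ h, map_zero]
    by_cases hi : i ∈ I
    · rw [top i hi h, zero_smul]
    · rw [scaledSingle_of_notMem _ hi, smul_zero]

/-! ### Coordinates of the generators on the explicit modules -/

namespace DChain

variable {q : Kˣ} (d : DChain q)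

theorem coef_smul (r : BaseRing K) (v : d.Mod) :
    D.coef K q r • v = weightOp q d.a d.b d.I r v :=
  LinearMap.congr_fun (show d.rep (D.coef K q r) = _ by simp [rep, D.coef, D.gen]) v

theorem X_smul (v : d.Mod) : D.X K q • v = shiftOp d.I 1 d.x v :=
  LinearMap.congr_fun (show d.rep (D.X K q) = _ by simp [rep, D.X, D.gen]) v

theorem Y_smul (v : d.Mod) : D.Y K q • v = shiftOp d.I (-1) d.y v :=
  LinearMap.congr_fun (show d.rep (D.Y K q) = _ by simp [rep, D.Y, D.gen]) v

theorem Y₁_smul (v : d.Mod) : D.Y₁ K q • v = shiftOp d.I (-1) d.z v :=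
  LinearMap.congr_fun (show d.rep (D.Y₁ K q) = _ by simp [rep, D.Y₁, D.gen]) v

end DChain

/-- The operators by which the generators of a generalized Weyl algebra act. -/
theorem GChain.rep_gen {q : Kˣ} {t : BaseRing K} (d : GChain q t) (g : GGen K) :
    d.rep (RingQuot.mkAlgHom K _ (FreeAlgebra.ι K g)) = match g with
      | .coef r => weightOp q d.a d.b d.I r
      | .X => shiftOp d.I 1 d.x
      | .T => shiftOp d.I (-1) d.y := by
  cases g <;> simp [rep]

theorem toAq_gen (q : Kˣ) (g : GGen K) :
    toAq K q (RingQuot.mkAlgHom K _ (FreeAlgebra.ι K g)) = match g with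
      | .coef r => D.coef K q r
      | .X => D.X K q
      | .T => D.Y₁ K q := by
  cases g <;> simp [toAq]

theorem toA1_gen (q : Kˣ) (g : GGen K) :
    toA1 K q (RingQuot.mkAlgHom K _ (FreeAlgebra.ι K g)) = match g with
      | .coef r => D.coef K q r
      | .X => D.X K q
      | .T => D.Y K q := by
  cases g <;> simp [toA1]

namespace IsWeightFamily

variable {q : Kˣ} {V : Type v} [AddCommGroup V] [Module K V] [Module (D K q) V]
  {I : Set ℤ} {a : K} {b : Kˣ} {w : ℤ → V}

theorem tau (h : IsWeightFamily q I a b w) (i : ℤ) : D.coef K q (tau K) • w i = (a + i) • w i := by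
  rw [h.coef, pt_tau]

theorem Y' (h : IsWeightFamily q I a b w) (i : ℤ) :
    D.Y K q • w (i + 1) = pt q a b i (QDiff.tau K) • w i := by
  rw [h.Y, pt_tau]

theorem Y₁' (h : IsWeightFamily q I a b w) (i : ℤ) :
    D.Y₁ K q • w (i + 1) = pt q a b i (kappa q) • w i := by
  rw [h.Y₁, pt_kappa]

theorem span_restrict (h : IsWeightFamily q I a b w) :
    Submodule.span K (Set.range fun i : I => w i) = ⊤ := by
  rw [eq_top_iff, ← h.span, Submodule.span_le]
  rintro _ ⟨i, rfl⟩
  by_cases hi : i ∈ I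
  · exact Submodule.subset_span ⟨⟨i, hi⟩, rfl⟩
  · rw [h.zero i hi]
    exact Submodule.zero_mem _

theorem linearMap_ext (h : IsWeightFamily q I a b w) {W : Type*} [AddCommGroup W] [Module K W]
    {f g : V →ₗ[K] W} (hfg : ∀ i, f (w i) = g (w i)) : f = g :=
  LinearMap.ext_on_range h.span hfg

/-- Reindexing of a weight basis indexed by all integers. -/
theorem shift (h : IsWeightFamily q Set.univ a b w) (n : ℤ) :
    IsWeightFamily q Set.univ (a + n) (q ^ n * b) fun i => w (i + n) where
  zero i hi := absurd (Set.mem_univ i) hi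
  ne i _ := h.ne _ (Set.mem_univ _)
  coef i r := by
    have : pt q a b (i + n) = pt q (a + n) (q ^ n * b) i := hom_extR
      (by rw [pt_tau, pt_tau]; push_cast; ring) (by rw [pt_sigma, pt_sigma, ← mul_assoc, zpow_add])
    rw [h.coef, this]
  X i _ := by rw [h.X _ (Set.mem_univ _), add_right_comm]
  Y i := by
    rw [add_right_comm, h.Y]
    congr 1
    push_cast
    ring
  Y₁ i := by rw [add_right_comm, h.Y₁, ← mul_assoc, ← zpow_add, add_right_comm]
  span := by
    rw [← h.span]
    congr 1
    exact (Equiv.addRight n).surjective.range_comp w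

/-- An integral `τ`-coordinate can be moved to 0 along the orbit; the price is a power of `q` in
`b`. -/
theorem shift_to_zero {n : ℤ} (h : IsWeightFamily q Set.univ (n : K) b w) :
    IsWeightFamily q Set.univ 0 (q ^ (-n) * b) fun i => w (i + -n) := by
  simpa using h.shift (-n)

/-! ### From a normalized basis to isomorphisms -/

variable [IsScalarTower K (D K q) V]

/-- The `w i` are eigenvectors of `τ` with distinct eigenvalues `a + i`. The eigenvalues of `σ`
would not do, since they repeat when `q` is a root of unity. -/
theorem linearIndependent [CharZero K] (h : IsWeightFamily q I a b w) :
    LinearIndependent K fun i : I => w i :=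
  Module.End.eigenvectors_linearIndependent' (Algebra.lsmul K K V (D.coef K q (QDiff.tau K)))
    (fun i : I => a + i) (fun i j hij => by
      have := add_left_cancel hij
      exact Subtype.ext (Int.cast_injective this)) _
    fun i => Module.End.hasEigenvector_iff.2
      ⟨Module.End.mem_eigenspace_iff.2 (h.tau i), h.ne i i.2⟩

theorem exists_linearEquiv [CharZero K] (h : IsWeightFamily q I a b w) {c : ℤ → K}
    (hc : ∀ i, c i ≠ 0) : ∃ e : V ≃ₗ[K] (I →₀ K), ∀ i, e (w i) = scaledSingle I c i := by
  -- The new basis is `(c i)⁻¹ • w i`, so that `w i` has coordinate `c i`.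
  let B := (Module.Basis.mk h.linearIndependent h.span_restrict.ge).unitsSMul
    fun i => (Units.mk0 (c i) (hc i))⁻¹
  refine ⟨B.repr, fun i => ?_⟩
  by_cases hi : i ∈ I
  · have hB : w i = c i • B ⟨i, hi⟩ := by
      simp [B, Module.Basis.unitsSMul_apply, Units.smul_def, hc]
    rw [hB, map_smul, Module.Basis.repr_self, scaledSingle_of_mem _ hi, Finsupp.smul_single,
      smul_eq_mul, mul_one]
  · rw [h.zero i hi, scaledSingle_of_notMem _ hi, map_zero]

/-- A linear isomorphism onto the vector space underlying a module `d.Mod`, compatible with the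
generators. -/
theorem exists_intertwiner [CharZero K] (h : IsWeightFamily q I a b w) {x : ℤ → K}
    (hx : ∀ i ∈ I, i + 1 ∈ I → x i ≠ 0) :
    ∃ e : V ≃ₗ[K] (I →₀ K),
      (∀ r v, e (D.coef K q r • v) = weightOp q a b I r (e v)) ∧
      (∀ v, e (D.X K q • v) = shiftOp I 1 x (e v)) ∧
      ∀ (T : D K q) (t : BaseRing K) (y : ℤ → K),
        (∀ i, T • w (i + 1) = pt q a b i t • w i) →
        (∀ i ∈ I, i + 1 ∈ I → x i * y (i + 1) = pt q a b i t) →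
        (∀ i ∈ I, i + 1 ∉ I → pt q a b i t = 0) → ∀ v, e (T • v) = shiftOp I (-1) y (e v) := by
  -- The scaling depends on `x` alone, so one and the same `e` intertwines all lowering operators;
  -- for `D` this covers `Y` and `Y₁` simultaneously.
  obtain ⟨c, hc, hc'⟩ := exists_int_scaling x
  have hc'' : ∀ i ∈ I, i + 1 ∈ I → c (i + 1) = x i * c i := fun i hi hi' => hc' i (hx i hi hi')
  obtain ⟨e, he⟩ := h.exists_linearEquiv hc
  have key : ∀ (g : D K q) (T : Module.End K (I →₀ K)), (∀ i, e (g • w i) = T (e (w i))) →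
      ∀ v, e (g • v) = T (e v) := fun g T hT v => by
    have : e.toLinearMap ∘ₗ (Algebra.lsmul K K V g) = T ∘ₗ e.toLinearMap := h.linearMap_ext hT
    exact LinearMap.congr_fun this v
  refine ⟨e, fun r => key _ _ fun i => ?_, key _ _ fun i => ?_, fun T t y hT mid top =>
    key _ _ fun i => ?_⟩
  · rw [h.coef, map_smul, he, weightOp_scaledSingle]
  · by_cases hi : i ∈ I
    · rw [h.X i hi, he, he, shiftOp_up_scaledSingle hc'' hi]
    · rw [h.zero i hi, smul_zero, map_zero, map_zero]
  · obtain ⟨i, rfl⟩ : ∃ j, i = j + 1 := ⟨i - 1, by ring⟩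
    rw [hT, map_smul, he, he, shiftOp_down_scaledSingle hc'' mid top]

/-- When the inner `X`-arrows are nonzero, the coefficients of `Y` and `Y₁` are forced by those of
`X` through `midY` and `midY₁`; hence support and base point determine the module. -/
theorem nonempty_equiv [CharZero K] (d : DChain q) (h : IsWeightFamily q d.I d.a d.b w)
    (hx : ∀ i ∈ d.I, i + 1 ∈ d.I → d.x i ≠ 0) : Nonempty (V ≃ₗ[D K q] d.Mod) := by
  obtain ⟨e, hc, hX, hT⟩ := h.exists_intertwiner hx
  let e' : V ≃ₗ[K] d.Mod := e
  have := map_smul_of_gen (W := d.Mod) e'.toLinearMap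
    (fun r v => (hc r v).trans (d.coef_smul _ _).symm)
    (fun v => (hX v).trans (d.X_smul _).symm)
    (fun v => (hT _ _ _ h.Y' (by simpa using d.midY)
      (by simpa using d.topY) v).trans (d.Y_smul _).symm)
    (fun v => (hT _ _ _ h.Y₁' (by simpa only [pt_kappa] using d.midY₁)
      (by simpa only [pt_kappa] using d.topY₁) v).trans
        (d.Y₁_smul _).symm)
  exact ⟨{ e' with map_smul' := this }⟩

theorem extendsAq [CharZero K] (d : GChain q (kappa q)) (h : IsWeightFamily q d.I d.a d.b w)
    (hx : ∀ i ∈ d.I, i + 1 ∈ d.I → d.x i ≠ 0) : ExtendsAq q V d := by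
  obtain ⟨e, hc, hX, hT⟩ := h.exists_intertwiner hx
  let e' : V ≃ₗ[K] d.Mod := e
  refine ⟨e', map_smul_of_ggen (toAq K q) d e'.toLinearMap fun g v => ?_⟩
  rw [toAq_gen, GChain.rep_gen]
  cases g with
  | coef r => exact hc r v
  | X => exact hX v
  | T => exact hT _ _ _ h.Y₁' d.mid d.top v

theorem extendsA1 [CharZero K] (d : GChain q (QDiff.tau K)) (h : IsWeightFamily q d.I d.a d.b w)
    (hx : ∀ i ∈ d.I, i + 1 ∈ d.I → d.x i ≠ 0) : ExtendsA1 q V d := by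
  obtain ⟨e, hc, hX, hT⟩ := h.exists_intertwiner hx
  let e' : V ≃ₗ[K] d.Mod := e
  refine ⟨e', map_smul_of_ggen (toA1 K q) d e'.toLinearMap fun g v => ?_⟩
  rw [toA1_gen, GChain.rep_gen]
  cases g with
  | coef r => exact hc r v
  | X => exact hX v
  | T => exact hT _ _ _ h.Y' d.mid d.top v

theorem of_equiv {W : Type*} [AddCommGroup W] [Module K W] [Module (D K q) W]
    [IsScalarTower K (D K q) W] (h : IsWeightFamily q I a b w) (e : V ≃ₗ[D K q] W) :
    IsWeightFamily q I a b fun i => e (w i) where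
  zero i hi := by rw [h.zero i hi, map_zero]
  ne i hi := by
    rw [Ne, e.map_eq_zero_iff]
    exact h.ne i hi
  coef i r := by
    rw [← map_smul, h.coef]
    exact map_smul (e.restrictScalars K) _ _
  X i hi := by rw [← map_smul, h.X i hi]
  Y i := by
    rw [← map_smul, h.Y]
    exact map_smul (e.restrictScalars K) _ _
  Y₁ i := by
    rw [← map_smul, h.Y₁]
    exact map_smul (e.restrictScalars K) _ _
  span := by
    have := congrArg (Submodule.map (e.restrictScalars K).toLinearMap) h.span
    rw [Submodule.map_span, ← Set.range_comp, Submodule.map_top, LinearEquiv.range] at this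
    exact this

end IsWeightFamily

/-- The basis `c(i) v_i`, with `c` the cumulative products of `x`, absorbs the coefficients of `X`
and turns those of `Y` and `Y₁` into values of `τ` and `qσ - 1`. -/
theorem DChain.exists_isWeightFamily {q : Kˣ} (d : DChain q)
    (hx : ∀ i ∈ d.I, i + 1 ∈ d.I → d.x i ≠ 0) :
    ∃ w : ℤ → d.Mod, IsWeightFamily q d.I d.a d.b w := by
  obtain ⟨c, hc, hc'⟩ := exists_int_scaling d.x
  have hc'' : ∀ i ∈ d.I, i + 1 ∈ d.I → c (i + 1) = d.x i * c i :=
    fun i hi hi' => hc' i (hx i hi hi')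
  refine ⟨scaledSingle d.I c, fun i hi => scaledSingle_of_notMem _ hi,
    fun i hi => scaledSingle_ne_zero hc hi, fun i r => ?_, fun i hi => ?_, fun i => ?_, fun i => ?_,
    span_scaledSingle _ hc⟩
  · exact (d.coef_smul r _).trans (weightOp_scaledSingle q d.a d.b d.I c i r)
  · exact (d.X_smul _).trans (shiftOp_up_scaledSingle hc'' hi)
  · exact (d.Y_smul _).trans (shiftOp_down_scaledSingle hc'' d.midY d.topY i)
  · exact (d.Y₁_smul _).trans (shiftOp_down_scaledSingle hc'' d.midY₁ d.topY₁ i)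

end WeightFamily

/-! ### Stable subspaces, simplicity and indecomposability -/

section Simplicity

variable {K : Type u} [Field K] {q : Kˣ} {V : Type v} [AddCommGroup V] [Module K V]
  [Module (D K q) V]

/-- The only subspaces of `V` stable under all elements of `s` are the trivial ones. -/
def NoStableSubspace (V : Type v) [AddCommGroup V] [Module K V] [Module (D K q) V]
    (s : Set (D K q)) : Prop :=
  ∀ N : Submodule K V, (∀ g ∈ s, ∀ v ∈ N, g • v ∈ N) → N = ⊥ ∨ N = ⊤

/-- Submodules are the stable `K`-subspaces. This form makes simplicity over `D`, `A_q` and `A_1`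
comparable inside one lattice of `K`-subspaces. -/
theorem isSimpleModule_iff_of_algebra {A : Type*} [Ring A] [Algebra K A] [Module A V]
    [IsScalarTower K A V] : IsSimpleModule A V ↔ Nontrivial V ∧
      ∀ N : Submodule K V, (∀ g : A, ∀ v ∈ N, g • v ∈ N) → N = ⊥ ∨ N = ⊤ := by
  constructor
  · intro h
    refine ⟨IsSimpleModule.nontrivial A V, fun N hN => ?_⟩
    let N' : Submodule A V := { N with smul_mem' := fun g v hv => hN g v hv }
    have hN' : ∀ v, v ∈ N' ↔ v ∈ N := fun _ => Iff.rfl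
    rcases eq_bot_or_eq_top N' with h' | h'
    · left
      ext v
      rw [← hN', h', Submodule.mem_bot, Submodule.mem_bot]
    · right
      ext v
      rw [← hN', h']
      simp
  · rintro ⟨_, h⟩
    rw [isSimpleModule_iff]
    refine { exists_pair_ne := ⟨⊥, ⊤, bot_ne_top⟩, eq_bot_or_eq_top := fun N => ?_ }
    rcases h (N.restrictScalars K) (fun g v hv => N.smul_mem g hv) with h' | h'
    · exact Or.inl ((Submodule.restrictScalars_eq_bot_iff K A V).1 h')
    · exact Or.inr ((Submodule.restrictScalars_eq_top_iff K A V).1 h')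

theorem IsWeightFamily.nontrivial {I : Set ℤ} {a : K} {b : Kˣ} {w : ℤ → V}
    (h : IsWeightFamily q I a b w) (hI : I.Nonempty) : Nontrivial V :=
  let ⟨i, hi⟩ := hI
  ⟨⟨w i, 0, h.ne i hi⟩⟩

variable [IsScalarTower K (D K q) V]

theorem isSimpleModule_adjoin_iff (s : Set (D K q)) :
    IsSimpleModule (Algebra.adjoin K s) V ↔ Nontrivial V ∧ NoStableSubspace V s := by
  rw [isSimpleModule_iff_of_algebra (K := K)]
  refine and_congr_right fun _ => forall_congr' fun N => imp_congr_left ⟨fun h g hg v hv => ?_,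
    fun h g v hv => smul_mem_of_mem_adjoin h g.2 v hv⟩
  exact h ⟨g, Algebra.subset_adjoin hg⟩ v hv

theorem isSimpleModule_D_iff : IsSimpleModule (D K q) V ↔ Nontrivial V ∧
    NoStableSubspace V (Set.range (D.coef K q) ∪ {D.X K q, D.Y K q, D.Y₁ K q}) := by
  rw [isSimpleModule_iff_of_algebra (K := K)]
  refine and_congr_right fun _ => forall_congr' fun N => imp_congr_left ⟨fun h g _ => h g,
    fun h g v hv => smul_mem_of_mem_adjoin h (by rw [adjoin_gen_eq_top]; trivial) v hv⟩

namespace IsWeightFamily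

variable {I : Set ℤ} {a : K} {b : Kˣ} {w : ℤ → V}

/-- A nonzero subspace stable under `R` contains a basis vector. -/
theorem exists_mem_of_stable [CharZero K] (h : IsWeightFamily q I a b w)
    {N : Submodule K V}
    (hN : ∀ r, ∀ v ∈ N, D.coef K q r • v ∈ N) (hN₀ : N ≠ ⊥) : ∃ i ∈ I, w i ∈ N := by
  obtain ⟨v, hv, hv₀⟩ := Submodule.exists_mem_ne_zero_of_ne_bot hN₀
  obtain ⟨c, hc⟩ := Finsupp.mem_span_range_iff_exists_finsupp.1
    (h.span_restrict.ge (Submodule.mem_top (x := v)))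
  have hc₀ : c ≠ 0 := by
    rintro rfl
    exact hv₀ (by simpa using hc.symm)
  obtain ⟨i, hi⟩ := Finsupp.support_nonempty_iff.2 hc₀
  refine ⟨i, i.2, ?_⟩
  -- An interpolation polynomial in `τ`: it kills every component of `v` except the one at `i`.
  let r : BaseRing K := ∏ j ∈ c.support.erase i,
    (QDiff.tau K - algebraMap K (BaseRing K) (a + ((j : ℤ) : K)))
  have hr : ∀ k, pt q a b k r = ∏ j ∈ c.support.erase i, ((k : K) - ((j : ℤ) : K)) := fun k => by
    simp [r]
  have hi' : c i * pt q a b i r ≠ 0 := by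
    refine mul_ne_zero (Finsupp.mem_support_iff.1 hi) ?_
    rw [hr, Finset.prod_ne_zero_iff]
    intro j hj
    rw [sub_ne_zero]
    intro hij
    exact Finset.ne_of_mem_erase hj (Subtype.ext (Int.cast_injective hij)).symm
  have key : D.coef K q r • v = (c i * pt q a b i r) • w i := by
    rw [← hc, Finsupp.sum, Finset.smul_sum, Finset.sum_eq_single_of_mem i hi]
    · rw [smul_comm, h.coef, smul_smul]
    · intro j hj hji
      have : pt q a b j r = 0 := by
        rw [hr]
        exact Finset.prod_eq_zero (Finset.mem_erase.2 ⟨hji, hj⟩) (sub_self _)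
      rw [smul_comm, h.coef, this, zero_smul, smul_zero]
  have := hN r v hv
  rw [key] at this
  exact (N.smul_mem_iff hi').1 this

/-- All upward arrows are present, so only the lowering operators in `s` can obstruct. If none of
them leads from `i + 1` to `i`, the part above `i` is stable and proper. Otherwise membership of `w
i` and of `w (i + 1)` in a stable subspace are equivalent, and one basis vector brings in all of
them. -/
theorem noStableSubspace_iff [CharZero K] (h : IsWeightFamily q I a b w)
    (hI : I.OrdConnected) {s : Set (D K q)}
    (hs : ∀ T ∈ s, ∀ i, ∃ c : K, T • w (i + 1) = c • w i) :
    NoStableSubspace V (Set.range (D.coef K q) ∪ insert (D.X K q) s) ↔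
      ∀ i ∈ I, i + 1 ∈ I → ∃ T ∈ s, T • w (i + 1) ≠ 0 := by
  constructor
  · intro H i hi hi'
    by_contra! hT
    -- The part above `i`: it contains `w (i + 1)`, and by linear independence not `w i`.
    let N := Submodule.span K ((fun j : I => w j) '' {j | i < j})
    have hN : ∀ j, i < j → w j ∈ N := fun j hj => by
      by_cases hjI : j ∈ I
      · exact Submodule.subset_span ⟨⟨j, hjI⟩, hj, rfl⟩
      · rw [h.zero j hjI]
        exact N.zero_mem
    have hwi : w i ∉ N := h.linearIndependent.notMem_span_image (x := ⟨i, hi⟩) (lt_irrefl i)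
    have hst : ∀ g ∈ Set.range (D.coef K q) ∪ insert (D.X K q) s, ∀ v ∈ N, g • v ∈ N := by
      intro g hg v hv
      induction hv using Submodule.span_induction with
      | zero => rw [smul_zero]; exact N.zero_mem
      | add u v _ _ hu hv => rw [smul_add]; exact N.add_mem hu hv
      | smul c v _ hv => rw [smul_comm]; exact N.smul_mem c hv
      | mem v hv =>
        obtain ⟨j, hj, rfl⟩ := hv
        rcases hg with ⟨r, rfl⟩ | rfl | hg
        · dsimp only
          rw [h.coef]
          exact N.smul_mem _ (hN j hj)
        · dsimp only
          rw [h.X j j.2]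
          exact hN _ (hj.trans (lt_add_one _))
        · obtain ⟨k, hk⟩ : ∃ k, (j : ℤ) = k + 1 := ⟨j - 1, by ring⟩
          have hj' : i < j := hj
          dsimp only
          rcases (show i ≤ k by omega).eq_or_lt with rfl | hik
          · rw [hk, hT g hg]
            exact N.zero_mem
          · obtain ⟨c, hc⟩ := hs g hg k
            rw [hk, hc]
            exact N.smul_mem _ (hN k hik)
    rcases H N hst with h' | h'
    · have := hN _ (lt_add_one i)
      rw [h', Submodule.mem_bot] at this
      exact h.ne _ hi' this
    · exact hwi (by rw [h']; trivial)
  · intro H N hN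
    refine or_iff_not_imp_left.2 fun hN₀ => ?_
    obtain ⟨m, hm, hmN⟩ := h.exists_mem_of_stable (fun r => hN _ (Or.inl ⟨r, rfl⟩)) hN₀
    have := ordConnected_int_induction hI (Q := fun i => w i ∈ N) (fun i hi hi' => ?_) hm hmN
    · rw [eq_top_iff, ← h.span_restrict, Submodule.span_le]
      rintro _ ⟨i, rfl⟩
      exact this i i.2
    · refine ⟨fun hw => ?_, fun hw => ?_⟩
      · rw [← h.X i hi]
        exact hN _ (Or.inr (Or.inl rfl)) _ hw
      · obtain ⟨T, hT, hTw⟩ := H i hi hi'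
        obtain ⟨c, hc⟩ := hs T hT i
        have hc₀ : c ≠ 0 := by
          rintro rfl
          exact hTw (by rw [hc, zero_smul])
        have := hN T (Or.inr (Or.inr hT)) _ hw
        rw [hc] at this
        exact (N.smul_mem_iff hc₀).1 this

theorem isSimpleModule_Aq_iff [CharZero K] (h : IsWeightFamily q I a b w)
    (hI : I.OrdConnected) (hI₀ : I.Nonempty) :
    IsSimpleModule (Aq K q) V ↔ ∀ i ∈ I, i + 1 ∈ I → q ^ (i + 1) * b ≠ 1 := by
  have := h.nontrivial hI₀
  rw [Aq, isSimpleModule_adjoin_iff, h.noStableSubspace_iff hI, and_iff_right this]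
  · refine forall_congr' fun i => forall_congr' fun hi => forall_congr' fun _ => ?_
    simp only [Set.mem_singleton_iff, exists_eq_left]
    rw [h.Y₁, smul_ne_zero_iff, sub_ne_zero, and_iff_left (h.ne i hi), Ne, Units.val_eq_one]
  · rintro _ rfl i
    exact ⟨_, h.Y₁ i⟩

theorem isSimpleModule_A1_iff [CharZero K] (h : IsWeightFamily q I a b w)
    (hI : I.OrdConnected) (hI₀ : I.Nonempty) :
    IsSimpleModule (A1 K q) V ↔ ∀ i ∈ I, i + 1 ∈ I → a + i ≠ 0 := by
  have := h.nontrivial hI₀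
  rw [A1, isSimpleModule_adjoin_iff, h.noStableSubspace_iff hI, and_iff_right this]
  · refine forall_congr' fun i => forall_congr' fun hi => forall_congr' fun _ => ?_
    simp only [Set.mem_singleton_iff, exists_eq_left]
    rw [h.Y, smul_ne_zero_iff, and_iff_left (h.ne i hi)]
  · rintro _ rfl i
    exact ⟨_, h.Y i⟩

theorem isSimpleModule_D_iff [CharZero K] (h : IsWeightFamily q I a b w)
    (hI : I.OrdConnected) (hI₀ : I.Nonempty) :
    IsSimpleModule (D K q) V ↔ ∀ i ∈ I, i + 1 ∈ I → a + i ≠ 0 ∨ q ^ (i + 1) * b ≠ 1 := by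
  have := h.nontrivial hI₀
  rw [QDiff.isSimpleModule_D_iff, h.noStableSubspace_iff hI, and_iff_right this]
  · refine forall_congr' fun i => forall_congr' fun hi => forall_congr' fun _ => ?_
    simp only [Set.mem_insert_iff, Set.mem_singleton_iff, or_and_right, exists_or, exists_eq_left]
    rw [h.Y₁, h.Y, smul_ne_zero_iff, smul_ne_zero_iff, sub_ne_zero, and_iff_left (h.ne i hi),
      and_iff_left (h.ne i hi), Ne, Ne, Ne, Units.val_eq_one]
  · rintro _ (rfl | rfl) i
    · exact ⟨_, h.Y i⟩
    · exact ⟨_, h.Y₁ i⟩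

theorem isWeightModule (h : IsWeightFamily q I a b w) : IsWeightModule q V := by
  rw [IsWeightModule, eq_top_iff, ← h.span, Submodule.span_le]
  rintro _ ⟨i, rfl⟩
  have hs : Function.Surjective (pt q a b i) := fun c => ⟨algebraMap K _ c, by simp⟩
  refine Submodule.mem_iSup_of_mem
    ⟨RingHom.ker (pt q a b i), RingHom.ker_isMaximal_of_surjective _ hs⟩ fun r hr => ?_
  rw [h.coef, RingHom.mem_ker.1 hr, zero_smul]

end IsWeightFamily

/-- Over a subalgebra that contains `R` and `X`, a module with a normalized weight basis along a
whole orbit is indecomposable. -/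
theorem IsWeightFamily.isIndecomposable [CharZero K] {a : K} {b : Kˣ} {w : ℤ → V}
    (h : IsWeightFamily q Set.univ a b w) (A : Subalgebra K (D K q))
    (hA : ∀ r, D.coef K q r ∈ A) (hX : D.X K q ∈ A) : IsIndecomposable A V := by
  refine ⟨h.nontrivial Set.univ_nonempty, fun W₁ W₂ hW => ?_⟩
  -- On a whole orbit `X` never kills a basis vector, so every nonzero submodule contains an upper
  -- tail of the basis, and any two tails meet.
  have hup : ∀ W : Submodule A V, W ≠ ⊥ → ∃ i, ∀ j, i ≤ j → w j ∈ W := fun W hW₀ => by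
    obtain ⟨i, -, hi⟩ := h.exists_mem_of_stable (N := W.restrictScalars K)
      (fun r v hv => W.smul_mem ⟨_, hA r⟩ hv) (by simpa using hW₀)
    refine ⟨i, fun j hj => ?_⟩
    induction j, hj using Int.leInduction with
    | base => exact hi
    | succ j _ hj =>
      rw [← h.X j (Set.mem_univ j)]
      exact W.smul_mem ⟨_, hX⟩ hj
  by_contra! hne
  obtain ⟨i, hi⟩ := hup W₁ hne.1
  obtain ⟨j, hj⟩ := hup W₂ hne.2
  have : w (max i j) ∈ W₁ ⊓ W₂ := ⟨hi _ (le_max_left _ _), hj _ (le_max_right _ _)⟩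
  rw [hW.inf_eq_bot, Submodule.mem_bot] at this
  exact h.ne _ (Set.mem_univ _) this

/-- If the arrow `X` out of `v_m` vanishes, then the `v_i` with `i ≤ m` span a submodule. -/
theorem DChain.not_isSimpleModule (d : DChain q) {m : ℤ} (hm : m ∈ d.I) (hm' : m + 1 ∈ d.I)
    (hx : d.x m = 0) : ¬ IsSimpleModule (D K q) d.Mod := by
  rw [isSimpleModule_D_iff]
  rintro ⟨-, H⟩
  -- The part at or below `m`. Arbitrary coefficient functions `c` are admitted because the shift
  -- formulas change them; `N` is the same subspace viewed in `d.Mod`.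
  let N₀ : Submodule K (d.I →₀ K) :=
    Submodule.span K {v : d.I →₀ K | ∃ i ≤ m, ∃ c, v = scaledSingle d.I c i}
  let N : Submodule K d.Mod := N₀
  have hN : ∀ i ≤ m, ∀ c, scaledSingle d.I c i ∈ N₀ := fun i hi c =>
    Submodule.subset_span ⟨i, hi, c, rfl⟩
  have down : ∀ (y : ℤ → K) i, i ≤ m → ∀ c, shiftOp d.I (-1) y (scaledSingle d.I c i) ∈ N₀ :=
    fun y i hi c => by
      by_cases hiI : i ∈ d.I
      · rw [shiftOp_scaledSingle _ _ _ hiI]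
        exact hN _ (by omega) _
      · rw [scaledSingle_of_notMem _ hiI, map_zero]
        exact N₀.zero_mem
  have hop : ∀ T : Module.End K (d.I →₀ K), (∀ i ≤ m, ∀ c, T (scaledSingle d.I c i) ∈ N₀) →
      ∀ v ∈ N₀, T v ∈ N₀ := fun T hT => by
    change N₀ ≤ N₀.comap T
    refine Submodule.span_le.2 ?_
    rintro _ ⟨i, hi, c, rfl⟩
    exact hT i hi c
  have hst : ∀ g ∈ Set.range (D.coef K q) ∪ {D.X K q, D.Y K q, D.Y₁ K q},
      ∀ v ∈ N, g • v ∈ N := by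
    intro g hg v hv
    rcases hg with ⟨r, rfl⟩ | rfl | rfl | rfl
    · rw [d.coef_smul]
      refine hop _ (fun i hi c => ?_) v hv
      rw [weightOp_scaledSingle]
      exact N₀.smul_mem _ (hN i hi c)
    · rw [d.X_smul]
      refine hop _ (fun i hi c => ?_) v hv
      by_cases hiI : i ∈ d.I
      · rw [shiftOp_scaledSingle _ _ _ hiI]
        -- Only `i = m` could leave the subspace, and there the coefficient of `X` is zero.
        rcases hi.eq_or_lt with rfl | hi'
        · rw [scaledSingle_of_mem _ hm', add_sub_cancel_right, hx, zero_mul, Finsupp.single_zero]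
          exact N₀.zero_mem
        · exact hN _ (by omega) _
      · rw [scaledSingle_of_notMem _ hiI, map_zero]
        exact N₀.zero_mem
    · rw [d.Y_smul]
      exact hop _ (down _) v hv
    · rw [d.Y₁_smul]
      exact hop _ (down _) v hv
  rcases H N hst with h' | h'
  · have h₀ : N₀ = ⊥ := h'
    have := hN m le_rfl 1
    rw [h₀, Submodule.mem_bot] at this
    exact scaledSingle_ne_zero (fun _ => one_ne_zero) hm this
  · have h₁ : N₀ = ⊤ := h'
    -- The coordinate at `m + 1` vanishes on `N₀`, so `N₀` is proper.
    have hle : N₀ ≤ LinearMap.ker (Finsupp.lapply (⟨m + 1, hm'⟩ : d.I) : (d.I →₀ K) →ₗ[K] K) := by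
      refine Submodule.span_le.2 ?_
      rintro _ ⟨i, hi, c, rfl⟩
      by_cases hiI : i ∈ d.I
      · rw [scaledSingle_of_mem _ hiI]
        have : (⟨i, hiI⟩ : d.I) ≠ ⟨m + 1, hm'⟩ := fun e => by
          have := congrArg Subtype.val e
          dsimp only at this
          omega
        simp [this]
      · rw [scaledSingle_of_notMem _ hiI]
        exact zero_mem _
    rw [h₁] at hle
    have : (Finsupp.single ⟨m + 1, hm'⟩ (1 : K) : d.I →₀ K) ∈ LinearMap.ker
      (Finsupp.lapply (⟨m + 1, hm'⟩ : d.I) : (d.I →₀ K) →ₗ[K] K) := hle Submodule.mem_top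
    simp at this

end Simplicity

/-! ### Classification of the irreducible weight modules -/

section Classification

variable {K : Type u} [Field K]

theorem D.Y₁_mul_coef_tau (q : Kˣ) :
    D.Y₁ K q * D.coef K q (tau K - 1) = D.Y K q * D.coef K q (sigma K - 1) :=
  (map_mul _ _ _).symm.trans ((RingQuot.mkAlgHom_rel K DRel.Y₁Y).trans (map_mul _ _ _))

/-- Every maximal ideal of `R` is the kernel of the evaluation at a point. -/
theorem exists_pt_sub_mem [IsAlgClosed K] (q : Kˣ) (𝔪 : MaximalSpectrum (BaseRing K)) :
    ∃ (a : K) (b : Kˣ), ∀ r, r - algebraMap K (BaseRing K) (pt q a b 0 r) ∈ 𝔪.asIdeal := by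
  have := 𝔪.isMaximal
  let F := BaseRing K ⧸ 𝔪.asIdeal
  let _ : Field F := Ideal.Quotient.field _
  have : Algebra.FiniteType (MvPolynomial (Fin 2) K) (BaseRing K) :=
    IsLocalization.finiteType_of_monoid_fg
      (Submonoid.powers (MvPolynomial.X 1 : MvPolynomial (Fin 2) K)) _
  have : Algebra.FiniteType K (BaseRing K) :=
    Algebra.FiniteType.trans (S := MvPolynomial (Fin 2) K) inferInstance inferInstance
  have : Algebra.FiniteType K F := inferInstance
  -- Zariski's lemma: the residue field is finite over `K`, hence equal to `K`, and the residues of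
  -- `τ` and `σ` are the coordinates of the point.
  have : Module.Finite K F := finite_of_finite_type_of_isJacobsonRing K F
  let e : K ≃ₐ[K] F := AlgEquiv.ofBijective (Algebra.ofId K F)
    (IsAlgClosed.algebraMap_bijective_of_isIntegral (k := K) (K := F))
  let φ : BaseRing K →ₐ[K] K := e.symm.toAlgHom.comp (Ideal.Quotient.mkₐ K 𝔪.asIdeal)
  refine ⟨φ (tau K), ((isUnit_sigma K).map φ).unit, fun r => ?_⟩
  have hφ : pt q (φ (tau K)) ((isUnit_sigma K).map φ).unit 0 = φ :=
    hom_extR (by simp) (by rw [pt_sigma, zpow_zero, one_mul, IsUnit.unit_spec])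
  rw [hφ, ← Ideal.Quotient.eq]
  change _ = algebraMap K F (φ r)
  exact (e.apply_symm_apply _).symm

variable (q : Kˣ) {V : Type v} [AddCommGroup V] [Module K V] [Module (D K q) V]

/-- `u` is a weight vector of weight `(τ - a - i, σ - q ^ i b)`, or `0`. -/
def HasWeight (a : K) (b : Kˣ) (i : ℤ) (u : V) : Prop :=
  ∀ r, D.coef K q r • u = pt q a b i r • u

variable {q} {a : K} {b : Kˣ} {i : ℤ} {u : V}

theorem HasWeight.zero [IsScalarTower K (D K q) V] : HasWeight q a b i (0 : V) := fun r => by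
  rw [smul_zero, smul_zero]

theorem HasWeight.Y_X (h : HasWeight q a b i u) : D.Y K q • D.X K q • u = (a + i) • u := by
  rw [← mul_smul, D.Y_mul_X, h, pt_tau]

theorem HasWeight.Y₁_X (h : HasWeight q a b i u) :
    D.Y₁ K q • D.X K q • u = (((q ^ (i + 1) * b : Kˣ) : K) - 1) • u := by
  rw [← mul_smul, D.Y₁_mul_X, h, pt_kappa]

theorem HasWeight.X_Y (h : HasWeight q a b (i + 1) u) :
    D.X K q • D.Y K q • u = (a + i) • u := by
  rw [← mul_smul, D.X_mul_Y, h, pt_alpha, pt_tau, add_sub_cancel_right]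

theorem HasWeight.X_Y₁ (h : HasWeight q a b (i + 1) u) :
    D.X K q • D.Y₁ K q • u = (((q ^ (i + 1) * b : Kˣ) : K) - 1) • u := by
  rw [← mul_smul, D.X_mul_Y₁, h, pt_alpha, pt_kappa, add_sub_cancel_right]

variable [IsScalarTower K (D K q) V]

theorem HasWeight.X (h : HasWeight q a b i u) : HasWeight q a b (i + 1) (D.X K q • u) := fun r => by
  have := D.X_mul_coef K q ((alpha q).symm r)
  rw [AlgEquiv.apply_symm_apply] at this
  rw [← mul_smul, ← this, mul_smul, h, pt_alpha_symm, smul_comm]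

theorem HasWeight.Y (h : HasWeight q a b (i + 1) u) : HasWeight q a b i (D.Y K q • u) := fun r => by
  have := D.Y_mul_coef K q (alpha q r)
  rw [AlgEquiv.symm_apply_apply] at this
  rw [← mul_smul, ← this, mul_smul, h, pt_alpha, add_sub_cancel_right, smul_comm]

theorem HasWeight.Y₁ (h : HasWeight q a b (i + 1) u) : HasWeight q a b i (D.Y₁ K q • u) :=
  fun r => by
  have := D.Y₁_mul_coef K q (alpha q r)
  rw [AlgEquiv.symm_apply_apply] at this
  rw [← mul_smul, ← this, mul_smul, h, pt_alpha, add_sub_cancel_right, smul_comm]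

theorem HasWeight.smul (h : HasWeight q a b i u) (c : K) : HasWeight q a b i (c • u) := fun r => by
  rw [smul_comm, h, smul_comm]

/-- The relation `Y₁ (τ - 1) = Y (σ - 1)` read on weight `i + 1`. There `τ - 1` and `σ - 1` take the
values that `τ` and `qσ - 1` take at index `i`, so the scalars are those that detect breaks at `i`.
-/
theorem HasWeight.compat (h : HasWeight q a b (i + 1) u) :
    (a + i) • D.Y₁ K q • u = (((q ^ (i + 1) * b : Kˣ) : K) - 1) • D.Y K q • u := by
  have h₁ : a + i = pt q a b (i + 1) (tau K - 1) := by
    rw [map_sub, pt_tau, map_one]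
    push_cast
    ring
  have h₂ : (((q ^ (i + 1) * b : Kˣ) : K) - 1) = pt q a b (i + 1) (sigma K - 1) := by
    rw [map_sub, pt_sigma, map_one]
  rw [h₁, h₂, smul_comm, ← h, smul_comm (_ : K), ← h, ← mul_smul, ← mul_smul, D.Y₁_mul_coef_tau]

/-- A weight vector can be divided by `X` if its predecessor is not a break for both algebras. -/
theorem HasWeight.exists_X_smul_eq (h : HasWeight q a b (i + 1) u)
    (hi : a + i ≠ 0 ∨ q ^ (i + 1) * b ≠ 1) :
    ∃ u' : V, HasWeight q a b i u' ∧ D.X K q • u' = u ∧ D.Y K q • u = (a + i) • u' ∧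
      D.Y₁ K q • u = (((q ^ (i + 1) * b : Kˣ) : K) - 1) • u' := by
  -- Divide by whichever scalar is nonzero: `u'` is a multiple of `Y₁ u` if `a + i = 0`, where
  -- `compat` gives `Y u = 0`, and a multiple of `Y u` otherwise, where `compat` recovers `Y₁ u`.
  by_cases ha : a + i = 0
  · have hb : (((q ^ (i + 1) * b : Kˣ) : K) - 1) ≠ 0 := by
      rw [sub_ne_zero, Ne, Units.val_eq_one]
      exact hi.resolve_left (not_not_intro ha)
    have hc := h.compat
    rw [ha, zero_smul, eq_comm, smul_eq_zero_iff_right hb] at hc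
    refine ⟨_, h.Y₁.smul (((q ^ (i + 1) * b : Kˣ) : K) - 1)⁻¹, ?_, ?_, ?_⟩
    · rw [smul_comm, h.X_Y₁, inv_smul_smul₀ hb]
    · rw [hc, ha, zero_smul]
    · rw [smul_inv_smul₀ hb]
  · refine ⟨_, h.Y.smul (a + i)⁻¹, ?_, ?_, ?_⟩
    · rw [smul_comm, h.X_Y, inv_smul_smul₀ ha]
    · rw [smul_inv_smul₀ ha]
    · rw [smul_comm, ← h.compat, inv_smul_smul₀ ha]

/-- A nonzero family of weight vectors in a simple module, closed under the generators. -/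
theorem IsWeightFamily.of_isSimpleModule [IsSimpleModule (D K q) V] {I : Set ℤ}
    (hI : I.OrdConnected) {w : ℤ → V} (hbr : ∀ i ∈ I, i + 1 ∈ I → a + i ≠ 0 ∨ q ^ (i + 1) * b ≠ 1)
    {m : ℤ} (hm : m ∈ I) (hw : w m ≠ 0) (zero : ∀ i ∉ I, w i = 0)
    (weight : ∀ i, HasWeight q a b i (w i))
    (rel : ∀ i, (i ∈ I → D.X K q • w i = w (i + 1)) ∧ D.Y K q • w (i + 1) = (a + i) • w i ∧
      D.Y₁ K q • w (i + 1) = (((q ^ (i + 1) * b : Kˣ) : K) - 1) • w i) :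
    IsWeightFamily q I a b w where
  zero := zero
  ne := by
    -- Neighbours vanish together: `X` carries zero upwards, and away from a common break `Y` or
    -- `Y₁` carries it downwards with a nonzero scalar.
    refine ordConnected_int_induction hI (fun i hi hi' => ?_) hm hw
    have h := rel i
    refine not_congr ⟨fun h₀ => ?_, fun h₀ => ?_⟩
    · rw [← h.1 hi, h₀, smul_zero]
    · rw [h₀, smul_zero, smul_zero] at h
      rcases hbr i hi hi' with hne | hne
      · exact (smul_eq_zero_iff_right hne).1 h.2.1.symm
      · refine (smul_eq_zero_iff_right ?_).1 h.2.2.symm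
        rwa [sub_ne_zero, Ne, Units.val_eq_one]
  coef := weight
  X i := (rel i).1
  Y i := (rel i).2.1
  Y₁ i := (rel i).2.2
  span := by
    have hmem : ∀ j, w j ∈ Submodule.span K (Set.range w) := fun j =>
      Submodule.subset_span ⟨j, rfl⟩
    -- The span is stable under the generators and contains `w m ≠ 0`, so simplicity makes it
    -- everything.
    refine ((QDiff.isSimpleModule_D_iff.1 ‹_›).2 (Submodule.span K (Set.range w)) ?_).resolve_left
      fun h => hw ?_
    · intro g hg v hv
      induction hv using Submodule.span_induction with
      | zero => rw [smul_zero]; exact Submodule.zero_mem _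
      | add u v _ _ hu hv => rw [smul_add]; exact Submodule.add_mem _ hu hv
      | smul c v _ hv => rw [smul_comm]; exact Submodule.smul_mem _ c hv
      | mem v hv =>
        obtain ⟨j, rfl⟩ := hv
        obtain ⟨k, rfl⟩ : ∃ k, j = k + 1 := ⟨j - 1, by ring⟩
        rcases hg with ⟨r, rfl⟩ | rfl | rfl | rfl
        · rw [weight]
          exact Submodule.smul_mem _ _ (hmem _)
        · by_cases hk : k + 1 ∈ I
          · rw [(rel _).1 hk]
            exact hmem _
          · rw [zero _ hk, smul_zero]
            exact Submodule.zero_mem _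
        · rw [(rel k).2.1]
          exact Submodule.smul_mem _ _ (hmem _)
        · rw [(rel k).2.2]
          exact Submodule.smul_mem _ _ (hmem _)
    · have := hmem m
      rwa [h, Submodule.mem_bot] at this

theorem exists_isWeightFamily_univ [IsSimpleModule (D K q) V]
    (hbr : ∀ i : ℤ, a + i ≠ 0 ∨ q ^ (i + 1) * b ≠ 1) (hu : HasWeight q a b 0 u) (hu₀ : u ≠ 0) :
    ∃ w : ℤ → V, IsWeightFamily q Set.univ a b w := by
  obtain ⟨w, hw₀, hw, hrel⟩ := exists_int_seq (HasWeight q a b)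
    (fun i u u' => D.X K q • u = u' ∧ D.Y K q • u' = (a + i) • u ∧
      D.Y₁ K q • u' = (((q ^ (i + 1) * b : Kˣ) : K) - 1) • u) 0 u hu
    (fun i _ u hu => ⟨_, hu.X, rfl, hu.Y_X, hu.Y₁_X⟩)
    (fun i _ u hu => hu.exists_X_smul_eq (hbr i))
  exact ⟨w, .of_isSimpleModule Set.ordConnected_univ (fun i _ _ => hbr i) (Set.mem_univ 0)
    (hw₀ ▸ hu₀) (fun i hi => absurd (Set.mem_univ i) hi) hw
    fun i => ⟨fun _ => (hrel i).1, (hrel i).2⟩⟩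

/-! ### The orbit with a common break of both algebras -/

/-- With `a = 0` the element `τ` vanishes only at index 0, so 0 is the only candidate for a common
break. -/
theorem no_double_break [CharZero K] (q : Kˣ) {i : ℤ} (hi : i ≠ 0) :
    (0 : K) + i ≠ 0 ∨ q ^ (i + 1) * q⁻¹ ≠ 1 :=
  Or.inl (by rwa [zero_add, Int.cast_ne_zero])

theorem exists_isWeightFamily_Iic [CharZero K] [IsSimpleModule (D K q) V]
    (hu : HasWeight q 0 q⁻¹ 0 u) (hu₀ : u ≠ 0) (hX : D.X K q • u = 0) :
    ∃ w : ℤ → V, IsWeightFamily q (Set.Iic 0) 0 q⁻¹ w := by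
  obtain ⟨w, hw₀, hw, hrel⟩ := exists_int_seq
    -- The invariant carries the boundary data through the recursion: the vector at 0 is killed by
    -- `X`, and everything above it is zero.
    (fun i (u : V) => HasWeight q 0 q⁻¹ i u ∧ (i = 0 → D.X K q • u = 0) ∧ (0 < i → u = 0))
    (fun i u u' => (i ∈ Set.Iic (0 : ℤ) → D.X K q • u = u') ∧ D.Y K q • u' = ((0 : K) + i) • u ∧
      D.Y₁ K q • u' = (((q ^ (i + 1) * q⁻¹ : Kˣ) : K) - 1) • u) 0 u
    ⟨hu, fun _ => hX, fun h => absurd h (lt_irrefl 0)⟩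
    (fun i hi u ⟨_, hu₁, hu₂⟩ => by
      refine ⟨0, ⟨.zero, fun _ => smul_zero _, fun _ => rfl⟩, fun h => hu₁ (le_antisymm h hi), ?_⟩
      -- At index 0 both scalars vanish; above it the vector itself does.
      rcases hi.eq_or_lt with rfl | hi
      · simp
      · simp [hu₂ hi])
    (fun i hi u ⟨hu, _, _⟩ => by
      obtain ⟨u', h₁, h₂, h₃⟩ := hu.exists_X_smul_eq (no_double_break q hi.ne)
      exact ⟨u', ⟨h₁, fun h => absurd h hi.ne, fun h => absurd h hi.not_gt⟩, fun _ => h₂, h₃⟩)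
  refine ⟨w, .of_isSimpleModule Set.ordConnected_Iic (fun i _ hi => ?_) (Set.mem_Iic.2 le_rfl)
    (hw₀ ▸ hu₀) (fun i hi => (hw i).2.2 (not_le.1 hi)) (fun i => (hw i).1) hrel⟩
  refine no_double_break q ?_
  rintro rfl
  simp at hi

theorem exists_isWeightFamily_Ici [CharZero K] [IsSimpleModule (D K q) V]
    (hu : HasWeight q 0 q⁻¹ 1 u) (hu₀ : u ≠ 0) (hY : D.Y K q • u = 0) (hY₁ : D.Y₁ K q • u = 0) :
    ∃ w : ℤ → V, IsWeightFamily q (Set.Ici 1) 0 q⁻¹ w := by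
  obtain ⟨w, hw₀, hw, hrel⟩ := exists_int_seq
    -- The mirror invariant: the vector at 1 is killed by `Y` and `Y₁`, and everything below it is
    -- zero.
    (fun i (u : V) => HasWeight q 0 q⁻¹ i u ∧ (i = 1 → D.Y K q • u = 0 ∧ D.Y₁ K q • u = 0) ∧
      (i < 1 → u = 0))
    (fun i u u' => (i ∈ Set.Ici (1 : ℤ) → D.X K q • u = u') ∧ D.Y K q • u' = ((0 : K) + i) • u ∧
      D.Y₁ K q • u' = (((q ^ (i + 1) * q⁻¹ : Kˣ) : K) - 1) • u) 1 u
    ⟨hu, fun _ => ⟨hY, hY₁⟩, fun h => absurd h (lt_irrefl 1)⟩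
    (fun i hi u ⟨hu, _, _⟩ => ⟨_, ⟨hu.X, fun h => by omega, fun h => by omega⟩,
      fun _ => rfl, hu.Y_X, hu.Y₁_X⟩)
    (fun i hi u ⟨_, hu₁, hu₂⟩ => by
      refine ⟨0, ⟨.zero, fun _ => ⟨smul_zero _, smul_zero _⟩, fun _ => rfl⟩,
        fun h => absurd h (not_le.2 hi), ?_⟩
      rw [smul_zero, smul_zero]
      rcases (show i + 1 ≤ 1 by omega).eq_or_lt with hi | hi
      · exact hu₁ hi
      · simp [hu₂ hi])
  refine ⟨w, .of_isSimpleModule Set.ordConnected_Ici (fun i hi _ => ?_) (Set.mem_Ici.2 le_rfl)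
    (hw₀ ▸ hu₀) (fun i hi => (hw i).2.2 (not_le.1 hi)) (fun i => (hw i).1) hrel⟩
  refine no_double_break q ?_
  rintro rfl
  simp at hi

/-- Moving a weight vector up to the break at index `0` or down to index `1`. -/
theorem HasWeight.exists_at_break [CharZero K] (hu : HasWeight q 0 q⁻¹ i u) (hu₀ : u ≠ 0) :
    (∃ u' : V, HasWeight q 0 q⁻¹ 0 u' ∧ u' ≠ 0) ∨ ∃ u' : V, HasWeight q 0 q⁻¹ 1 u' ∧ u' ≠ 0 := by
  rcases le_or_gt i 0 with hi | hi
  · left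
    obtain ⟨n, hn⟩ := Int.le.dest hi
    induction n generalizing i u with
    | zero =>
      obtain rfl : i = 0 := by simpa using hn
      exact ⟨u, hu, hu₀⟩
    | succ n ih =>
      -- `X u` is nonzero because `Y X u = i u` with `i < 0`. Likewise on the other side `X Y u = (i
      -- - 1) u` with `i > 1`.
      refine ih hu.X (fun h => ?_) (by omega) (by omega)
      have := hu.Y_X
      rw [h, smul_zero, eq_comm, smul_eq_zero_iff_left hu₀, zero_add, Int.cast_eq_zero] at this
      omega
  · right
    obtain ⟨n, hn⟩ := Int.le.dest (show 1 ≤ i by omega)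
    induction n generalizing i u with
    | zero =>
      obtain rfl : i = 1 := by simpa using hn.symm
      exact ⟨u, hu, hu₀⟩
    | succ n ih =>
      obtain ⟨k, rfl⟩ : ∃ k, i = k + 1 := ⟨i - 1, by ring⟩
      refine ih hu.Y (fun h => ?_) (by omega) (by omega)
      have := hu.X_Y
      rw [h, smul_zero, eq_comm, smul_eq_zero_iff_left hu₀, zero_add, Int.cast_eq_zero] at this
      omega

/-- Going across the gap between 0 and 1 and back is zero in every way, since `τ` and `qσ - 1` both
vanish at index 0. So a weight vector next to the gap either is annihilated by the operators
crossing it or is sent to a nonzero vector, on the other side, that is. -/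
theorem exists_isWeightFamily_of_double_break [CharZero K] [IsSimpleModule (D K q) V]
    (hu : HasWeight q 0 q⁻¹ i u) (hu₀ : u ≠ 0) :
    (∃ w : ℤ → V, IsWeightFamily q (Set.Iic 0) 0 q⁻¹ w) ∨
      ∃ w : ℤ → V, IsWeightFamily q (Set.Ici 1) 0 q⁻¹ w := by
  rcases hu.exists_at_break hu₀ with ⟨u, hu, hu₀⟩ | ⟨u, hu, hu₀⟩
  · by_cases hX : D.X K q • u = 0
    · exact Or.inl (exists_isWeightFamily_Iic hu hu₀ hX)
    · exact Or.inr (exists_isWeightFamily_Ici hu.X hX (by simp [hu.Y_X]) (by simp [hu.Y₁_X]))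
  · have hu' : HasWeight q 0 q⁻¹ (0 + 1) u := hu
    by_cases hY : D.Y K q • u = 0
    · by_cases hY₁ : D.Y₁ K q • u = 0
      · exact Or.inr (exists_isWeightFamily_Ici hu hu₀ hY hY₁)
      · exact Or.inl (exists_isWeightFamily_Iic hu'.Y₁ hY₁ (by simp [hu'.X_Y₁]))
    · exact Or.inl (exists_isWeightFamily_Iic hu'.Y hY (by simp [hu'.X_Y]))

theorem IsIrreducibleWeight.exists_isWeightFamily [IsAlgClosed K] [CharZero K]
    (h : IsIrreducibleWeight q V) :
    (∃ (a : K) (b : Kˣ) (w : ℤ → V), IsWeightFamily q Set.univ a b w) ∨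
      (∃ w : ℤ → V, IsWeightFamily q (Set.Iic 0) 0 q⁻¹ w) ∨
      ∃ w : ℤ → V, IsWeightFamily q (Set.Ici 1) 0 q⁻¹ w := by
  obtain ⟨hs, hw⟩ := h
  have := IsSimpleModule.nontrivial (D K q) V
  obtain ⟨𝔪, h𝔪⟩ : ∃ 𝔪 : MaximalSpectrum (BaseRing K), weightSpace q V 𝔪.asIdeal ≠ ⊥ := by
    by_contra! h
    rw [IsWeightModule, iSup_eq_bot.2 h] at hw
    exact bot_ne_top hw
  obtain ⟨u, hu, hu₀⟩ := Submodule.exists_mem_ne_zero_of_ne_bot h𝔪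
  obtain ⟨a, b, hab⟩ := exists_pt_sub_mem q 𝔪
  have hwt : HasWeight q a b 0 u := fun r => by
    have := hu _ (hab r)
    rwa [map_sub, sub_smul, sub_eq_zero, AlgHom.commutes, algebraMap_smul] at this
  by_cases hbr : ∀ i : ℤ, a + i ≠ 0 ∨ q ^ (i + 1) * b ≠ 1
  · obtain ⟨w, hw⟩ := exists_isWeightFamily_univ hbr hwt hu₀
    exact Or.inl ⟨a, b, w, hw⟩
  · push Not at hbr
    obtain ⟨n, ha, hb⟩ := hbr
    -- A common break at `n` means `a = -n` and `b = q^{-n-1}`; measured from the break, the given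
    -- weight has index `-n`.
    have e : pt q a b 0 = pt q 0 q⁻¹ (-n) := hom_extR
      (by
        rw [pt_tau, pt_tau]
        push_cast
        linear_combination ha)
      (by
        rw [pt_sigma, pt_sigma, eq_inv_of_mul_eq_one_right hb]
        congr 1
        group)
    have hwt' : HasWeight q 0 q⁻¹ (-n) u := fun r => by rw [hwt r, e]
    exact Or.inr (exists_isWeightFamily_of_double_break hwt' hu₀)

end Classification

/-! ### Breaks, supports and extensions -/

section Breaks

variable {K : Type u} [Field K] {q : Kˣ} {t : BaseRing K} {a : K} {b : Kˣ}

/-- If a maximal break exists, the maximum of `B'` is its successor, which is not a break; so `J'`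
may contain every break. -/
theorem isAdmissible_breaks' : IsAdmissible q t a b (breaks' q t a b) (breaks q t a b) where
  subset := subset_rfl
  interval _ _ _ _ _ hj _ _ := hj
  subset' := Set.subset_union_left
  notMax m hm hmb := by
    have h : m + 1 ∈ breaks' q t a b := by
      refine Or.inr ?_
      rw [Set.mem_ofPred_eq, add_sub_cancel_right]
      exact ⟨hmb, fun k hk => hm.2 (Or.inl hk)⟩
    have := hm.2 h
    omega

theorem supportVJ_breaks' : supportVJ q t a b (breaks' q t a b) = Set.univ := by
  refine Set.eq_univ_of_forall fun i => ⟨fun n₀ hn => ?_, fun n₁ hn hb => ?_⟩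
  · exact absurd (hn.1.2 n₀ (Or.inl hn.1.1)) (lt_irrefl _)
  · exact absurd hb (isAdmissible_breaks'.notMax n₁ hn)

theorem breaks'_of_eq_singleton {m : ℤ} (h : breaks q t a b = {m}) :
    breaks' q t a b = {m, m + 1} := by
  ext i
  have : IsGreatest {m} (i - 1) ↔ i = m + 1 :=
    ⟨fun hi => by have := hi.1; rw [Set.mem_singleton_iff] at this; omega,
      fun hi => by rw [hi, add_sub_cancel_right]; exact isGreatest_singleton⟩
  simp only [breaks', h, Set.mem_union, Set.mem_singleton_iff, Set.mem_ofPred_eq, this,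
    Set.mem_insert_iff]

theorem isAdmissible_singleton {m : ℤ} (hm : m ∈ breaks' q t a b) :
    IsAdmissible q t a b {m} ∅ where
  subset := Set.singleton_subset_iff.2 hm
  interval i hi k hk j _ hij hjk := by
    rw [Set.mem_singleton_iff] at hi hk ⊢
    omega
  subset' := Set.empty_subset _
  notMax m _ := Set.notMem_empty m

theorem supportVJ_singleton {m : ℤ} (h : breaks q t a b = {m}) :
    supportVJ q t a b {m} = Set.Iic m := by
  ext i
  refine ⟨fun hi => hi.2 m isGreatest_singleton (by rw [h]; rfl), fun hi => ⟨fun n₀ hn => ?_,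
    fun n₁ hn _ => ?_⟩⟩
  · have h₁ := hn.1.1
    have h₂ := hn.1.2 m rfl
    rw [h, Set.mem_singleton_iff] at h₁
    omega
  · have := hn.1
    rw [Set.mem_singleton_iff] at this
    rw [Set.mem_Iic] at hi
    omega

/-- Here `m` plays the role of `𝔫₀`, and `m + 1` is not a break, so there is no upper bound. -/
theorem supportVJ_singleton_succ {m : ℤ} (h : breaks q t a b = {m}) :
    supportVJ q t a b {m + 1} = Set.Ici (m + 1) := by
  ext i
  have hm : IsGreatest {k | k ∈ breaks q t a b ∧ ∀ j ∈ ({m + 1} : Set ℤ), k < j} m := by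
    refine ⟨⟨by rw [h]; rfl, fun j hj => ?_⟩, fun k hk => ?_⟩
    · rw [Set.mem_singleton_iff] at hj
      omega
    · have := hk.1
      rw [h] at this
      exact le_of_eq this
  refine ⟨fun hi => hi.1 m hm, fun hi => ⟨fun n₀ hn => ?_, fun n₁ hn hb => ?_⟩⟩
  · rw [hn.unique hm]
    exact hi
  · have := hn.1
    rw [h, Set.mem_singleton_iff] at hb
    rw [Set.mem_singleton_iff] at this
    omega

theorem VJ_x_of_notMem {J J' : Set ℤ} (h : IsAdmissible q t a b J J') {i : ℤ}
    (hi : i ∉ breaks q t a b) : (VJ q t a b J J' h).x i = pt q a b i t := if_neg hi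

theorem VJ_x_of_mem {J J' : Set ℤ} (h : IsAdmissible q t a b J J') {i : ℤ}
    (hi : i ∈ J') : (VJ q t a b J J' h).x i = 1 :=
  (if_pos (h.subset_breaks hi)).trans (if_pos hi)

/-- Taking `J' = B` turns every vanishing `X`-arrow at a break into 1; this is why whole-orbit
normal forms restrict to `V(ω, B', B)`. -/
theorem VJ_breaks'_x_ne_zero (i : ℤ) :
    (VJ q t a b (breaks' q t a b) (breaks q t a b) isAdmissible_breaks').x i ≠ 0 := by
  by_cases hi : i ∈ breaks q t a b
  · rw [VJ_x_of_mem _ hi]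
    exact one_ne_zero
  · rw [VJ_x_of_notMem _ hi]
    exact hi

theorem breaks_kappa_eq_empty (hb : b ∉ Subgroup.zpowers q) : breaks q (kappa q) a b = ∅ :=
  Set.eq_empty_of_forall_notMem fun i hi => zpow_mul_val_ne_one hb (i + 1) (by
    rw [← pt_kappa q a]
    exact hi)

theorem breaks_kappa_nonempty (hb : b ∈ Subgroup.zpowers q) : (breaks q (kappa q) a b).Nonempty := by
  obtain ⟨n, rfl⟩ := hb
  refine ⟨-n - 1, ?_⟩
  change pt q a _ _ (kappa q) = 0
  rw [pt_kappa]
  simp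

theorem breaks_kappa_inv (hq : ¬ IsOfFinOrder q) : breaks q (kappa q) a q⁻¹ = {0} := by
  ext i
  change pt q a _ _ (kappa q) = 0 ↔ i = 0
  rw [pt_kappa, zpow_add_one_mul_inv]
  refine ⟨fun h => ?_, ?_⟩
  · by_contra hi
    exact zpow_val_ne_one hq hi h
  · rintro rfl
    simp

theorem breaks_tau_eq_empty (ha : ∀ n : ℤ, a ≠ n) : breaks q (tau K) a b = ∅ := by
  refine Set.eq_empty_of_forall_notMem fun i hi => ha (-i) ?_
  change pt q a b i (tau K) = 0 at hi
  rw [pt_tau] at hi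
  push_cast
  linear_combination hi

theorem breaks_tau_zero [CharZero K] : breaks q (tau K) 0 b = {0} := by
  ext i
  change pt q 0 b i (tau K) = 0 ↔ i = 0
  rw [pt_tau, zero_add, Int.cast_eq_zero]

/-! ### Restrictions of normal forms to the two subalgebras -/

namespace IsWeightFamily

variable [CharZero K] {V : Type v} [AddCommGroup V] [Module K V] [Module (D K q) V]
  [IsScalarTower K (D K q) V] {w : ℤ → V}

theorem extendsAq_VJ (h : IsWeightFamily q Set.univ a b w) :
    ExtendsAq q V
      (VJ q (kappa q) a b (breaks' q (kappa q) a b) (breaks q (kappa q) a b) isAdmissible_breaks') :=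
  extendsAq (w := w) _ (by rw [← supportVJ_breaks' (t := kappa q)] at h; exact h)
    fun i _ _ => VJ_breaks'_x_ne_zero i

theorem extendsA1_VJ (h : IsWeightFamily q Set.univ a b w) :
    ExtendsA1 q V (VJ q (QDiff.tau K) a b (breaks' q (QDiff.tau K) a b)
      (breaks q (QDiff.tau K) a b) isAdmissible_breaks') :=
  extendsA1 (w := w) _ (by rw [← supportVJ_breaks' (t := QDiff.tau K)] at h; exact h)
    fun i _ _ => VJ_breaks'_x_ne_zero i

/-- The only break is the upper end of the support, so no inner arrow vanishes. -/
theorem extendsAq_VJ_Iic (hB : breaks q (kappa q) a b = {0})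
    (h : IsWeightFamily q (Set.Iic 0) a b w) (hJ : IsAdmissible q (kappa q) a b {0} ∅) :
    ExtendsAq q V (VJ q (kappa q) a b {0} ∅ hJ) := by
  rw [← supportVJ_singleton hB] at h
  refine extendsAq _ h fun i _ hi => ?_
  change i + 1 ∈ supportVJ q (kappa q) a b {0} at hi
  rw [supportVJ_singleton hB, Set.mem_Iic] at hi
  have hi' : i ∉ breaks q (kappa q) a b := by
    rw [hB, Set.mem_singleton_iff]
    omega
  rw [VJ_x_of_notMem _ hi']
  exact hi'

theorem extendsA1_VJ_Iic (hB : breaks q (QDiff.tau K) a b = {0})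
    (h : IsWeightFamily q (Set.Iic 0) a b w) (hJ : IsAdmissible q (QDiff.tau K) a b {0} ∅) :
    ExtendsA1 q V (VJ q (QDiff.tau K) a b {0} ∅ hJ) := by
  rw [← supportVJ_singleton hB] at h
  refine extendsA1 _ h fun i _ hi => ?_
  change i + 1 ∈ supportVJ q (QDiff.tau K) a b {0} at hi
  rw [supportVJ_singleton hB, Set.mem_Iic] at hi
  have hi' : i ∉ breaks q (QDiff.tau K) a b := by
    rw [hB, Set.mem_singleton_iff]
    omega
  rw [VJ_x_of_notMem _ hi']
  exact hi'

/-- The only break lies just below the support, so no inner arrow vanishes. -/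
theorem extendsAq_VJ_Ici (hB : breaks q (kappa q) a b = {0})
    (h : IsWeightFamily q (Set.Ici 1) a b w) (hJ : IsAdmissible q (kappa q) a b {1} ∅) :
    ExtendsAq q V (VJ q (kappa q) a b {1} ∅ hJ) := by
  have hS := supportVJ_singleton_succ hB
  rw [zero_add] at hS
  rw [← hS] at h
  refine extendsAq _ h fun i hi _ => ?_
  change i ∈ supportVJ q (kappa q) a b {1} at hi
  rw [hS, Set.mem_Ici] at hi
  have hi' : i ∉ breaks q (kappa q) a b := by
    rw [hB, Set.mem_singleton_iff]
    omega
  rw [VJ_x_of_notMem _ hi']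
  exact hi'

theorem extendsA1_VJ_Ici (hB : breaks q (QDiff.tau K) a b = {0})
    (h : IsWeightFamily q (Set.Ici 1) a b w) (hJ : IsAdmissible q (QDiff.tau K) a b {1} ∅) :
    ExtendsA1 q V (VJ q (QDiff.tau K) a b {1} ∅ hJ) := by
  have hS := supportVJ_singleton_succ hB
  rw [zero_add] at hS
  rw [← hS] at h
  refine extendsA1 _ h fun i hi _ => ?_
  change i ∈ supportVJ q (QDiff.tau K) a b {1} at hi
  rw [hS, Set.mem_Ici] at hi
  have hi' : i ∉ breaks q (QDiff.tau K) a b := by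
    rw [hB, Set.mem_singleton_iff]
    omega
  rw [VJ_x_of_notMem _ hi']
  exact hi'

end IsWeightFamily

end Breaks

/-! ### Weight bases of the explicit modules -/

section ExplicitBases

variable {K : Type u} [Field K] {q : Kˣ}

theorem Vq_x_ne_zero (a : K) {b : Kˣ} (hb : b ∉ Subgroup.zpowers q) (i : ℤ) :
    (Vq q a b hb).x i ≠ 0 := zpow_mul_val_ne_one hb _

theorem VqNeg_x_ne_zero (hq : ¬ IsOfFinOrder q) (i : ℤ) (hi : i + 1 ∈ Set.Iic (0 : ℤ)) :
    (VqNeg q hq).x i ≠ 0 := zpow_val_ne_one hq (by rw [Set.mem_Iic] at hi; omega)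

theorem VqPos_x_ne_zero (hq : ¬ IsOfFinOrder q) (i : ℤ) (hi : i ∈ Set.Ici (1 : ℤ)) :
    (VqPos q hq).x i ≠ 0 := zpow_val_ne_one hq (by rw [Set.mem_Ici] at hi; omega)

theorem V1_x_ne_zero {a : K} (b : Kˣ) (ha : ∀ n : ℤ, a ≠ n) (i : ℤ) : (V1 q a b ha).x i ≠ 0 :=
  fun h => ha (-i) (by
    change a + i = 0 at h
    push_cast
    linear_combination h)

variable [CharZero K]

theorem V1Neg_x_ne_zero (i : ℤ) (hi : i + 1 ∈ Set.Iic (0 : ℤ)) : (V1Neg q).x i ≠ 0 :=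
  Int.cast_ne_zero.2 (by rw [Set.mem_Iic] at hi; omega)

theorem V1Pos_x_ne_zero (i : ℤ) (hi : i ∈ Set.Ici (1 : ℤ)) : (V1Pos q).x i ≠ 0 :=
  Int.cast_ne_zero.2 (by rw [Set.mem_Ici] at hi; omega)

theorem V1Full_x_ne_zero (b : Kˣ) (i : ℤ) : (V1Full q b).x i ≠ 0 := by
  change (if i = 0 then (1 : K) else i) ≠ 0
  split_ifs with h
  · exact one_ne_zero
  · exact Int.cast_ne_zero.2 h

end ExplicitBases

/-! ### The three families -/

section FamilyLists

variable {K : Type u} [Field K] [CharZero K] {q : Kˣ} {V : Type v} [AddCommGroup V] [Module K V]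
  [Module (D K q) V] [IsScalarTower K (D K q) V] {w : ℤ → V} {a : K} {b : Kˣ}

namespace IsWeightFamily

theorem isSimpleModule_Aq_univ_iff (h : IsWeightFamily q Set.univ a b w) :
    IsSimpleModule (Aq K q) V ↔ b ∉ Subgroup.zpowers q := by
  rw [h.isSimpleModule_Aq_iff Set.ordConnected_univ Set.univ_nonempty]
  refine ⟨?_, fun hb i _ _ hi => ?_⟩
  · rintro H ⟨n, rfl⟩
    exact H (-n - 1) (Set.mem_univ _) (Set.mem_univ _) (by simp)
  · refine zpow_mul_val_ne_one hb (i + 1) ?_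
    rw [hi, Units.val_one, sub_self]

theorem isSimpleModule_A1_univ_iff (h : IsWeightFamily q Set.univ a b w) :
    IsSimpleModule (A1 K q) V ↔ ∀ n : ℤ, a ≠ n := by
  rw [h.isSimpleModule_A1_iff Set.ordConnected_univ Set.univ_nonempty]
  refine ⟨fun H n hn => H (-n) (Set.mem_univ _) (Set.mem_univ _) (by simp [hn]),
    fun H i _ _ hi => H (-i) ?_⟩
  push_cast
  linear_combination hi

theorem isSimpleModule_A1_Iic (h : IsWeightFamily q (Set.Iic 0) 0 q⁻¹ w) :
    IsSimpleModule (A1 K q) V := by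
  rw [h.isSimpleModule_A1_iff Set.ordConnected_Iic Set.nonempty_Iic]
  intro i _ hi
  rw [Set.mem_Iic] at hi
  rw [zero_add, Int.cast_ne_zero]
  omega

theorem isSimpleModule_A1_Ici (h : IsWeightFamily q (Set.Ici 1) 0 q⁻¹ w) :
    IsSimpleModule (A1 K q) V := by
  rw [h.isSimpleModule_A1_iff Set.ordConnected_Ici Set.nonempty_Ici]
  intro i hi _
  rw [Set.mem_Ici] at hi
  rw [zero_add, Int.cast_ne_zero]
  omega

/-- For `b = q⁻¹` the scalar of `Y₁` on the step between `i` and `i + 1` is `q^i - 1`, and inner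
steps have `i ≤ -1`. If `q^n = 1` with `n > 0`, the step at `-n` is blocked. -/
theorem isSimpleModule_Aq_Iic_iff (h : IsWeightFamily q (Set.Iic 0) 0 q⁻¹ w) :
    IsSimpleModule (Aq K q) V ↔ ¬ IsOfFinOrder q := by
  rw [h.isSimpleModule_Aq_iff Set.ordConnected_Iic Set.nonempty_Iic]
  simp only [zpow_add_one_mul_inv, Set.mem_Iic]
  refine ⟨fun H hq => ?_, fun hq i _ hi hi' => hq (isOfFinOrder_iff_zpow_eq_one.2
    ⟨i, by omega, hi'⟩)⟩
  obtain ⟨n, hn, hqn⟩ := isOfFinOrder_iff_pow_eq_one.1 hq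
  exact H (-n) (by omega) (by omega) (by simp [hqn])

theorem isSimpleModule_Aq_Ici_iff (h : IsWeightFamily q (Set.Ici 1) 0 q⁻¹ w) :
    IsSimpleModule (Aq K q) V ↔ ¬ IsOfFinOrder q := by
  rw [h.isSimpleModule_Aq_iff Set.ordConnected_Ici Set.nonempty_Ici]
  simp only [zpow_add_one_mul_inv, Set.mem_Ici]
  refine ⟨fun H hq => ?_, fun hq i hi _ hi' => hq (isOfFinOrder_iff_zpow_eq_one.2
    ⟨i, by omega, hi'⟩)⟩
  obtain ⟨n, hn, hqn⟩ := isOfFinOrder_iff_pow_eq_one.1 hq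
  exact H n (by omega) (by omega) (by simp [hqn])

theorem isIrreducibleWeight_univ_iff (h : IsWeightFamily q Set.univ a b w) :
    IsIrreducibleWeight q V ↔ ∀ i : ℤ, a + i ≠ 0 ∨ q ^ (i + 1) * b ≠ 1 := by
  rw [IsIrreducibleWeight, and_iff_left h.isWeightModule,
    h.isSimpleModule_D_iff Set.ordConnected_univ Set.univ_nonempty]
  simp

/-- With `a = 0` only index 0 can be a common break, and there the second condition reads `q b = 1`.
-/
theorem isIrreducibleWeight_univ_zero_iff (h : IsWeightFamily q Set.univ 0 b w) :
    IsIrreducibleWeight q V ↔ b ≠ q⁻¹ := by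
  rw [h.isIrreducibleWeight_univ_iff]
  refine ⟨fun H hb => ?_, fun hb i => ?_⟩
  · have := H 0
    simp [hb] at this
  · rw [zero_add, Int.cast_ne_zero, or_iff_not_imp_left, not_not]
    rintro rfl hb'
    rw [zero_add, zpow_one] at hb'
    exact hb (eq_inv_of_mul_eq_one_right hb')

theorem isIrreducibleWeight_Iic (h : IsWeightFamily q (Set.Iic 0) 0 q⁻¹ w) :
    IsIrreducibleWeight q V := by
  refine ⟨?_, h.isWeightModule⟩
  rw [h.isSimpleModule_D_iff Set.ordConnected_Iic Set.nonempty_Iic]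
  intro i _ hi
  rw [Set.mem_Iic] at hi
  exact no_double_break q (by omega)

theorem isIrreducibleWeight_Ici (h : IsWeightFamily q (Set.Ici 1) 0 q⁻¹ w) :
    IsIrreducibleWeight q V := by
  refine ⟨?_, h.isWeightModule⟩
  rw [h.isSimpleModule_D_iff Set.ordConnected_Ici Set.nonempty_Ici]
  intro i hi _
  rw [Set.mem_Ici] at hi
  exact no_double_break q (by omega)

/-- The module with a normalized basis along the whole orbit through `(τ, σ - b)`, where `b ≠ q⁻¹`
is a power of `q`, belongs to the third family. -/
theorem familyIII (h : IsWeightFamily q Set.univ 0 b w) (hb : b ∈ Subgroup.zpowers q)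
    (hb' : b ≠ q⁻¹) : FamilyIII q V := by
  refine ⟨h.isIrreducibleWeight_univ_zero_iff.2 hb', ⟨?_, ?_⟩, ⟨?_, ?_⟩, 0, b,
    ⟨breaks_kappa_nonempty hb, _, _, _, h.extendsAq_VJ⟩, ⟨?_, _, _, _, h.extendsA1_VJ⟩⟩
  · exact h.isIndecomposable _ (fun r => Algebra.subset_adjoin (Or.inl ⟨r, rfl⟩))
      (Algebra.subset_adjoin (Or.inr (Or.inl rfl)))
  · rw [h.isSimpleModule_Aq_univ_iff]
    exact not_not_intro hb
  · exact h.isIndecomposable _ (fun r => Algebra.subset_adjoin (Or.inl ⟨r, rfl⟩))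
      (Algebra.subset_adjoin (Or.inr (Or.inl rfl)))
  · rw [h.isSimpleModule_A1_univ_iff]
    exact fun H => H 0 Int.cast_zero.symm
  · rw [breaks_tau_zero]
    exact Set.singleton_nonempty 0

theorem exists_familyIII {n : ℤ} (h : IsWeightFamily q Set.univ (n : K) b w)
    (hb : b ∈ Subgroup.zpowers q) (hV : IsIrreducibleWeight q V) :
    q ^ (-n) * b ∈ Subgroup.zpowers q ∧ q ^ (-n) * b ≠ q⁻¹ :=
  ⟨mul_mem (Subgroup.zpow_mem _ (Subgroup.mem_zpowers q) _) hb,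
    h.shift_to_zero.isIrreducibleWeight_univ_zero_iff.1 hV⟩

end IsWeightFamily

variable [IsAlgClosed K]

/-- Half lines are simple over `A_1`. A whole orbit is simple over `A_q` if `b ∉ ⟨q⟩`, over `A_1` if
`a ∉ ℤ`; in the remaining case a shift to `a = 0` gives Family III. -/
theorem familyI_or_familyII_or_familyIII (hV : IsIrreducibleWeight q V) :
    FamilyI q V ∨ FamilyII q V ∨ FamilyIII q V := by
  rcases hV.exists_isWeightFamily with ⟨a, b, w, hw⟩ | ⟨w, hw⟩ | ⟨w, hw⟩
  · by_cases hb : b ∈ Subgroup.zpowers q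
    · by_cases ha : ∀ n : ℤ, a ≠ n
      · exact Or.inr (Or.inl ⟨hV, hw.isSimpleModule_A1_univ_iff.2 ha⟩)
      · push Not at ha
        obtain ⟨n, rfl⟩ := ha
        obtain ⟨h₁, h₂⟩ := hw.exists_familyIII hb hV
        exact Or.inr (Or.inr (hw.shift_to_zero.familyIII h₁ h₂))
    · exact Or.inl ⟨hV, hw.isSimpleModule_Aq_univ_iff.2 hb⟩
  · exact Or.inr (Or.inl ⟨hV, hw.isSimpleModule_A1_Iic⟩)
  · exact Or.inr (Or.inl ⟨hV, hw.isSimpleModule_A1_Ici⟩)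

/-- The simplicity criterion over `A_q` supplies, for each shape of support, exactly the condition
under which the explicit module is defined. -/
theorem familyI_iff_listI : FamilyI q V ↔ ListI q V := by
  constructor
  · rintro ⟨hV, hs⟩
    rcases hV.exists_isWeightFamily with ⟨a, b, w, hw⟩ | ⟨w, hw⟩ | ⟨w, hw⟩
    · have hb := hw.isSimpleModule_Aq_univ_iff.1 hs
      exact Or.inl ⟨a, b, hb, hw.nonempty_equiv (Vq q a b hb) fun i _ _ => Vq_x_ne_zero a hb i⟩
    · have hq := hw.isSimpleModule_Aq_Iic_iff.1 hs
      exact Or.inr ⟨hq, Or.inl (hw.nonempty_equiv (VqNeg q hq) fun i _ => VqNeg_x_ne_zero hq i)⟩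
    · have hq := hw.isSimpleModule_Aq_Ici_iff.1 hs
      exact Or.inr ⟨hq, Or.inr (hw.nonempty_equiv (VqPos q hq) fun i hi _ =>
        VqPos_x_ne_zero hq i hi)⟩
  · rintro (⟨a, b, hb, ⟨e⟩⟩ | ⟨hq, ⟨⟨e⟩⟩ | ⟨⟨e⟩⟩⟩)
    · obtain ⟨w, hw⟩ := (Vq q a b hb).exists_isWeightFamily fun i _ _ => Vq_x_ne_zero a hb i
      have hw' : IsWeightFamily q Set.univ a b _ := hw.of_equiv e.symm
      refine ⟨hw'.isIrreducibleWeight_univ_iff.2 fun i => Or.inr fun hi => ?_,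
        hw'.isSimpleModule_Aq_univ_iff.2 hb⟩
      refine zpow_mul_val_ne_one hb (i + 1) ?_
      rw [hi, Units.val_one, sub_self]
    · obtain ⟨w, hw⟩ := (VqNeg q hq).exists_isWeightFamily fun i _ => VqNeg_x_ne_zero hq i
      have hw' : IsWeightFamily q (Set.Iic 0) 0 q⁻¹ _ := hw.of_equiv e.symm
      exact ⟨hw'.isIrreducibleWeight_Iic, hw'.isSimpleModule_Aq_Iic_iff.2 hq⟩
    · obtain ⟨w, hw⟩ := (VqPos q hq).exists_isWeightFamily fun i hi _ => VqPos_x_ne_zero hq i hi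
      have hw' : IsWeightFamily q (Set.Ici 1) 0 q⁻¹ _ := hw.of_equiv e.symm
      exact ⟨hw'.isIrreducibleWeight_Ici, hw'.isSimpleModule_Aq_Ici_iff.2 hq⟩

theorem familyII_iff_listII : FamilyII q V ↔ ListII q V := by
  constructor
  · rintro ⟨hV, hs⟩
    rcases hV.exists_isWeightFamily with ⟨a, b, w, hw⟩ | ⟨w, hw⟩ | ⟨w, hw⟩
    · have ha := hw.isSimpleModule_A1_univ_iff.1 hs
      exact Or.inl ⟨a, b, ha, hw.nonempty_equiv (V1 q a b ha) fun i _ _ => V1_x_ne_zero b ha i⟩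
    · exact Or.inr (Or.inl (hw.nonempty_equiv (V1Neg q) fun i _ => V1Neg_x_ne_zero i))
    · exact Or.inr (Or.inr (hw.nonempty_equiv (V1Pos q) fun i hi _ => V1Pos_x_ne_zero i hi))
  · rintro (⟨a, b, ha, ⟨e⟩⟩ | ⟨⟨e⟩⟩ | ⟨⟨e⟩⟩)
    · obtain ⟨w, hw⟩ := (V1 q a b ha).exists_isWeightFamily fun i _ _ => V1_x_ne_zero b ha i
      have hw' : IsWeightFamily q Set.univ a b _ := hw.of_equiv e.symm
      -- The coefficient of `X` in `V1` is `a + i` itself, so its nonvanishing excludes common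
      -- breaks.
      exact ⟨hw'.isIrreducibleWeight_univ_iff.2 fun i => Or.inl (V1_x_ne_zero (q := q) b ha i),
        hw'.isSimpleModule_A1_univ_iff.2 ha⟩
    · obtain ⟨w, hw⟩ := (V1Neg q).exists_isWeightFamily fun i _ => V1Neg_x_ne_zero i
      have hw' : IsWeightFamily q (Set.Iic 0) 0 q⁻¹ _ := hw.of_equiv e.symm
      exact ⟨hw'.isIrreducibleWeight_Iic, hw'.isSimpleModule_A1_Iic⟩
    · obtain ⟨w, hw⟩ := (V1Pos q).exists_isWeightFamily fun i hi _ => V1Pos_x_ne_zero i hi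
      have hw' : IsWeightFamily q (Set.Ici 1) 0 q⁻¹ _ := hw.of_equiv e.symm
      exact ⟨hw'.isIrreducibleWeight_Ici, hw'.isSimpleModule_A1_Ici⟩

/-- Half lines drop out because they are simple over `A_1`. On a whole orbit, failure of both
simplicity criteria means `b ∈ ⟨q⟩` and `a ∈ ℤ`, and after the shift to `a = 0` irreducibility over
`D` is `b ≠ q⁻¹`. -/
theorem familyIII_iff_listIII : FamilyIII q V ↔ ListIII q V := by
  constructor
  · rintro ⟨hV, ⟨-, hq⟩, ⟨-, h₁⟩, -⟩
    rcases hV.exists_isWeightFamily with ⟨a, b, w, hw⟩ | ⟨w, hw⟩ | ⟨w, hw⟩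
    · rw [hw.isSimpleModule_Aq_univ_iff, not_not] at hq
      rw [hw.isSimpleModule_A1_univ_iff] at h₁
      push Not at h₁
      obtain ⟨n, rfl⟩ := h₁
      obtain ⟨hb, hb'⟩ := hw.exists_familyIII hq hV
      exact ⟨_, hb, hb', hw.shift_to_zero.nonempty_equiv (V1Full q _)
        fun i _ _ => V1Full_x_ne_zero _ i⟩
    · exact absurd hw.isSimpleModule_A1_Iic h₁
    · exact absurd hw.isSimpleModule_A1_Ici h₁
  · rintro ⟨b, hb, hb', ⟨e⟩⟩
    obtain ⟨w, hw⟩ := (V1Full q b).exists_isWeightFamily fun i _ _ => V1Full_x_ne_zero b i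
    have hw' : IsWeightFamily q Set.univ 0 b _ := hw.of_equiv e.symm
    exact hw'.familyIII hb hb'

end FamilyLists

end QDiff

end

theorem mainTheorem3 (K : Type u) [Field K] [IsAlgClosed K] [CharZero K] (q : Kˣ) :
    -- every irreducible `D` weight module is in one of the three families
    (∀ (V : Type v) [AddCommGroup V] [Module K V] [Module (D K q) V] [IsScalarTower K (D K q) V],
      IsIrreducibleWeight q V → FamilyI q V ∨ FamilyII q V ∨ FamilyIII q V) ∧
    -- the three families are given by the explicit lists
    (∀ (V : Type v) [AddCommGroup V] [Module K V] [Module (D K q) V] [IsScalarTower K (D K q) V],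
      (FamilyI q V ↔ ListI q V) ∧ (FamilyII q V ↔ ListII q V) ∧ (FamilyIII q V ↔ ListIII q V)) ∧
    -- the `A_q`-modules extended by the modules of Family I
    (∀ (a : K) (b : Kˣ) (hb : b ∉ Subgroup.zpowers q), ∃ h : breaks q (kappa q) a b = ∅,
      ExtendsAq q (Vq q a b hb).Mod (Vomega q (kappa q) a b h)) ∧
    (∀ hq : ¬ IsOfFinOrder q,
      (∃ h : IsAdmissible q (kappa q) 0 q⁻¹ {0} ∅,
        ExtendsAq q (VqNeg q hq).Mod (VJ q (kappa q) 0 q⁻¹ {0} ∅ h)) ∧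
      (∃ h : IsAdmissible q (kappa q) 0 q⁻¹ {1} ∅,
        ExtendsAq q (VqPos q hq).Mod (VJ q (kappa q) 0 q⁻¹ {1} ∅ h))) ∧
    -- the `A_1`-modules extended by the modules of Family II
    (∀ (a : K) (b : Kˣ) (ha : ∀ n : ℤ, a ≠ n), ∃ h : breaks q (tau K) a b = ∅,
      ExtendsA1 q (V1 q a b ha).Mod (Vomega q (tau K) a b h)) ∧
    (∃ h : IsAdmissible q (tau K) 0 q⁻¹ {0} ∅,
      ExtendsA1 q (V1Neg q).Mod (VJ q (tau K) 0 q⁻¹ {0} ∅ h)) ∧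
    (∃ h : IsAdmissible q (tau K) 0 q⁻¹ {1} ∅,
      ExtendsA1 q (V1Pos q).Mod (VJ q (tau K) 0 q⁻¹ {1} ∅ h)) ∧
    -- the modules `V_1(ω, J, J', b)`: what they extend and when they are irreducible
    (∀ b : Kˣ,
      (∃ h : IsAdmissible q (tau K) 0 b {0, 1} {0},
        ExtendsA1 q (V1Full q b).Mod (VJ q (tau K) 0 b {0, 1} {0} h)) ∧
      (b ∈ Subgroup.zpowers q →
        ∃ h : IsAdmissible q (kappa q) 0 b (breaks' q (kappa q) 0 b) (breaks q (kappa q) 0 b),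
          ExtendsAq q (V1Full q b).Mod
            (VJ q (kappa q) 0 b (breaks' q (kappa q) 0 b) (breaks q (kappa q) 0 b) h)) ∧
      (IsIrreducibleWeight q (V1Full q b).Mod ↔ b ≠ q⁻¹)) ∧
    -- the modules `V_1(ω, J, J', c, d)` are never irreducible
    (∀ c d : K, ¬ IsSimpleModule (D K q) (V1Two q c d).Mod) := by
  refine ⟨fun V _ _ _ _ hV => familyI_or_familyII_or_familyIII hV,
    fun V _ _ _ _ => ⟨familyI_iff_listI, familyII_iff_listII, familyIII_iff_listIII⟩,
    fun a b hb => ⟨breaks_kappa_eq_empty hb, ?_⟩, fun hq => ?_,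
    fun a b ha => ⟨breaks_tau_eq_empty ha, ?_⟩, ?_, ?_, fun b => ?_, fun c d =>
      -- `X v_0 = 0` for all `c` and `d`, so the vectors of index at most 0 span a proper submodule.
      (V1Two q c d).not_isSimpleModule (m := 0) (Set.mem_univ _) (Set.mem_univ _) Int.cast_zero⟩
  · obtain ⟨w, hw⟩ := (Vq q a b hb).exists_isWeightFamily fun i _ _ => Vq_x_ne_zero a hb i
    have hB : breaks q (kappa q) a b = ∅ := breaks_kappa_eq_empty hb
    refine hw.extendsAq (Vomega q (kappa q) a b hB) fun i _ _ hi => ?_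
    have : i ∈ breaks q (kappa q) a b := hi
    rw [hB] at this
    exact this
  · have hB : breaks q (kappa q) (0 : K) q⁻¹ = {0} := breaks_kappa_inv hq
    have hB' := breaks'_of_eq_singleton hB
    refine ⟨⟨isAdmissible_singleton (by simp [hB']), ?_⟩,
      ⟨isAdmissible_singleton (by simp [hB']), ?_⟩⟩
    · obtain ⟨w, hw⟩ := (VqNeg q hq).exists_isWeightFamily fun i _ => VqNeg_x_ne_zero hq i
      exact IsWeightFamily.extendsAq_VJ_Iic hB hw _
    · obtain ⟨w, hw⟩ := (VqPos q hq).exists_isWeightFamily fun i hi _ => VqPos_x_ne_zero hq i hi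
      exact IsWeightFamily.extendsAq_VJ_Ici hB hw _
  · obtain ⟨w, hw⟩ := (V1 q a b ha).exists_isWeightFamily fun i _ _ => V1_x_ne_zero b ha i
    have hB : breaks q (tau K) a b = ∅ := breaks_tau_eq_empty ha
    refine hw.extendsA1 (Vomega q (tau K) a b hB) fun i _ _ hi => ?_
    have : i ∈ breaks q (tau K) a b := hi
    rw [hB] at this
    exact this
  · obtain ⟨w, hw⟩ := (V1Neg q).exists_isWeightFamily fun i _ => V1Neg_x_ne_zero i
    exact ⟨isAdmissible_singleton (by simp [breaks'_of_eq_singleton breaks_tau_zero]),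
      IsWeightFamily.extendsA1_VJ_Iic breaks_tau_zero hw _⟩
  · obtain ⟨w, hw⟩ := (V1Pos q).exists_isWeightFamily fun i hi _ => V1Pos_x_ne_zero i hi
    exact ⟨isAdmissible_singleton (by simp [breaks'_of_eq_singleton breaks_tau_zero]),
      IsWeightFamily.extendsA1_VJ_Ici breaks_tau_zero hw _⟩
  · obtain ⟨w, hw⟩ := (V1Full q b).exists_isWeightFamily fun i _ _ => V1Full_x_ne_zero b i
    have hw' : IsWeightFamily q Set.univ 0 b w := hw
    refine ⟨?_, fun _ => ⟨isAdmissible_breaks', hw'.extendsAq_VJ⟩,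
      hw'.isIrreducibleWeight_univ_zero_iff⟩
    have hB : breaks q (tau K) 0 b = {0} := breaks_tau_zero
    have hB' := breaks'_of_eq_singleton hB
    rw [zero_add] at hB'
    -- The only break of `τ` is 0, so `{0, 1}` and `{0}` are `B'` and `B`. The admissibility proof
    -- is kept under the existential so that both sets can be rewritten.
    have key : ∃ h, ExtendsA1 q (V1Full q b).Mod
        (VJ q (tau K) 0 b (breaks' q (tau K) 0 b) (breaks q (tau K) 0 b) h) :=
      ⟨isAdmissible_breaks', hw'.extendsA1_VJ⟩
    rwa [hB', hB] at key
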